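/- Let $N\in\mathbb N$, $p\in\{0\}\cup[1,\infty]$, let $E$ be a complex Banach space, and let $\mathbf X=l^p(\mathbb Z^N,E)$ with the usual $p$-norm, where $l^0(\mathbb Z^N,E)$ denotes the closure in $l^\infty(\mathbb Z^N,E)$ of the finitely supported sequences. For $n\in\mathbb N$ let $P_n$ be the operator of multiplication by the characteristic function of $\{-n,\dots,n\}^N$, put $\mathcal P=(P_n)$, and for $\alpha\in\mathbb Z^N$ let $V_\alpha(x_i)_i=(x_{i-\alpha})_i$. A bounded linear operator $K$ on $\mathbf X$ is $\mathcal P$-compact, $K\in\mathcal K(\mathbf X,\mathcal P)$, if $\|(I-P_n)K\|+\|K(I-P_n)\|\to0$; $\mathcal L(\mathbf X,\mathcal P)$ is the algebra of all bounded linear operators $A$ on $\mathbf X$ such that $AK$ and $KA$ are $\mathcal P$-compact for every $\mathcal P$-compact $K$. It contains $\mathcal K(\mathbf X,\mathcal P)$ as a closed two-sided ideal. A sequence $(A_n)$ of bounded linear operators converges $\mathcal P$-strongly to a bounded linear operator $B$ if $\|K(A_n-B)\|+\|(A_n-B)K\|\to0$ for every $K\in\mathcal K(\mathbf X,\mathcal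 P)$. For $A\in\mathcal L(\mathbf X,\mathcal P)$ and a sequence $h=(h_n)$ in $\mathbb Z^N$ with $|h_n|\to\infty$, the limit operator $A_h$ is the $\mathcal P$-strong limit of $V_{-h_n}AV_{h_n}$, if it exists; $\sigma^{\mathrm{op}}(A)$ is the set of all limit operators of $A$. $A$ is rich if every sequence $h$ in $\mathbb Z^N$ with $|h_n|\to\infty$ has a subsequence $g$ for which $A_g$ exists. A band operator is a finite sum $\sum_\alpha a_\alpha V_\alpha$ with multiplication operators $(a_\alpha x)_i=a_\alpha(i)x_i$, where $a_\alpha$ is a bounded function from $\mathbb Z^N$ to the bounded linear operators on $E$; $A$ is band-dominated if it is the limit, in operator norm, of a sequence of band operators. For an element $a$ of a unital complex algebra with unit $e$ and a norm, and $\varepsilon>0$, let $\mathrm{sp}_\varepsilon(a)=\{\lambda\in\mathbb C:\|(a-\lambda e)^{-1}\|>1/\varepsilon\}$, where $\|b^{-1}\|:=\infty$ if $b$ is not invertible. For a bounded linear operator on $\mathbf X$ this is taken in the algebra of all bounded linear operators on $\mathbf X$. The $\mathcal P$-essential $\varepsilon$-pseudospectrum $\mathrm{sp}_{\varepsilon,\mathrm{ess}}(A)$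 of $A\in\mathcal L(\mathbf X,\mathcal P)$ is the $\varepsilon$-pseudospectrum of the coset $A+\mathcal K(\mathbf X,\mathcal P)$ in the quotient algebra $\mathcal L(\mathbf X,\mathcal P)/\mathcal K(\mathbf X,\mathcal P)$ with the quotient norm. **Theorem.** Let $A\in\mathcal L(\mathbf X,\mathcal P)$ be rich and band-dominated, and let $\varepsilon>0$. Then $$\mathrm{sp}_{\varepsilon,\mathrm{ess}}(A)=\bigcup_{A_h\in\sigma^{\mathrm{op}}(A)}\mathrm{sp}_\varepsilon(A_h).$$ -/

import Mathlib

open Filter Topology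
open scoped ENNReal

noncomputable section

/-! ### Resolvent norms and pseudospectra in a complex algebra with a norm -/

open Classical in
/-- `‖b⁻¹‖ ∈ [0, ∞]`, with the convention `‖b⁻¹‖ = ∞` if `b` is not (two-sided) invertible. -/
def invNorm {B : Type*} [Ring B] [Norm B] (b : B) : ℝ≥0∞ :=
  if IsUnit b then ENNReal.ofReal ‖Ring.inverse b‖ else ⊤

/-- The `ε`-pseudospectrum `{z ∈ ℂ : ‖(a - z e)⁻¹‖ > 1/ε}` of an element `a` of a unital complex
algebra with a norm. -/
def epsPseudospectrum {B : Type*} [Ring B] [Algebra ℂ B] [Norm B] (ε : ℝ) (a : B) : Set ℂ :=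
  {z : ℂ | ENNReal.ofReal (1 / ε) < invNorm (a - algebraMap ℂ B z)}

/-! ### `P`-compact operators, the algebra `L(Y, P)`, and its quotient -/

section PNotions

variable {Y : Type*} [NormedAddCommGroup Y] [NormedSpace ℂ Y]

/-- `K` is `P`-compact: `‖(I - P n) K‖ + ‖K (I - P n)‖ → 0`. -/
def IsPCompact (P : ℕ → Y →L[ℂ] Y) (K : Y →L[ℂ] Y) : Prop :=
  Tendsto (fun n => ‖(1 - P n) * K‖ + ‖K * (1 - P n)‖) atTop (𝓝 0)

theorem isPCompact_iff (P : ℕ → Y →L[ℂ] Y) (K : Y →L[ℂ] Y) :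
    IsPCompact P K ↔ Tendsto (fun n => (1 - P n) * K) atTop (𝓝 0) ∧
      Tendsto (fun n => K * (1 - P n)) atTop (𝓝 0) := by
  unfold IsPCompact
  constructor
  · intro h
    constructor
    · refine squeeze_zero_norm (fun n => ?_) h
      exact le_add_of_nonneg_right (norm_nonneg _)
    · refine squeeze_zero_norm (fun n => ?_) h
      exact le_add_of_nonneg_left (norm_nonneg _)
  · rintro ⟨h1, h2⟩
    simpa using h1.norm.add h2.norm

theorem IsPCompact.zero (P : ℕ → Y →L[ℂ] Y) : IsPCompact P 0 := by
  simp [isPCompact_iff]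

theorem IsPCompact.add {P : ℕ → Y →L[ℂ] Y} {K L : Y →L[ℂ] Y} (hK : IsPCompact P K)
    (hL : IsPCompact P L) : IsPCompact P (K + L) := by
  rw [isPCompact_iff] at *
  refine ⟨?_, ?_⟩
  · simpa [mul_add] using hK.1.add hL.1
  · simpa [add_mul] using hK.2.add hL.2

theorem IsPCompact.smul {P : ℕ → Y →L[ℂ] Y} {K : Y →L[ℂ] Y} (c : ℂ) (hK : IsPCompact P K) :
    IsPCompact P (c • K) := by
  rw [isPCompact_iff] at *
  refine ⟨?_, ?_⟩
  · simpa using hK.1.const_smul c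
  · simpa using hK.2.const_smul c

/-- `L(Y, P)`: the bounded linear operators `A` such that `A K` and `K A` are `P`-compact for
every `P`-compact `K`. -/
def pAlgebra (P : ℕ → Y →L[ℂ] Y) : Subalgebra ℂ (Y →L[ℂ] Y) where
  carrier := {A | ∀ K, IsPCompact P K → IsPCompact P (A * K) ∧ IsPCompact P (K * A)}
  mul_mem' := by
    intro A B hA hB K hK
    refine ⟨?_, ?_⟩
    · rw [mul_assoc]; exact (hA _ (hB K hK).1).1
    · rw [← mul_assoc]; exact (hB _ (hA K hK).2).2
  add_mem' := by
    intro A B hA hB K hK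
    refine ⟨?_, ?_⟩
    · rw [add_mul]; exact (hA K hK).1.add (hB K hK).1
    · rw [mul_add]; exact (hA K hK).2.add (hB K hK).2
  algebraMap_mem' := by
    intro c K hK
    rw [Algebra.algebraMap_eq_smul_one]
    refine ⟨?_, ?_⟩
    · simpa using hK.smul c
    · simpa using hK.smul c

/-- The ideal `K(Y, P)` of all `P`-compact operators in `L(Y, P)`. -/
def pCompactIdeal (P : ℕ → Y →L[ℂ] Y) : Ideal (pAlgebra P) where
  carrier := {K | IsPCompact P (K : Y →L[ℂ] Y)}
  add_mem' := fun hK hL => IsPCompact.add hK hL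
  zero_mem' := IsPCompact.zero P
  smul_mem' := fun A K hK => (A.2 K hK).1

instance pCompactIdeal_isTwoSided (P : ℕ → Y →L[ℂ] Y) : (pCompactIdeal P).IsTwoSided :=
  ⟨fun {K} A hK => (A.2 K hK).2⟩

/-- Every `P`-compact operator belongs to `L(Y, P)`. -/
theorem IsPCompact.mem_pAlgebra {P : ℕ → Y →L[ℂ] Y} {K : Y →L[ℂ] Y} (hK : IsPCompact P K) :
    K ∈ pAlgebra P := by
  intro L hL
  rw [isPCompact_iff] at hK hL
  rw [isPCompact_iff, isPCompact_iff]
  refine ⟨⟨?_, ?_⟩, ⟨?_, ?_⟩⟩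
  · simpa [mul_assoc] using hK.1.mul_const L
  · simpa [mul_assoc] using hL.2.const_mul K
  · simpa [mul_assoc] using hL.1.mul_const K
  · simpa [mul_assoc] using hK.2.const_mul L

/-- The quotient algebra `L(Y, P) / K(Y, P)`. -/
def PQuotient (P : ℕ → Y →L[ℂ] Y) : Type _ := pAlgebra P ⧸ pCompactIdeal P

instance PQuotient.instRing (P : ℕ → Y →L[ℂ] Y) : Ring (PQuotient P) :=
  inferInstanceAs (Ring (pAlgebra P ⧸ pCompactIdeal P))

instance PQuotient.instAlgebra (P : ℕ → Y →L[ℂ] Y) : Algebra ℂ (PQuotient P) :=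
  inferInstanceAs (Algebra ℂ (pAlgebra P ⧸ pCompactIdeal P))

/-- The quotient norm. -/
instance PQuotient.instNorm (P : ℕ → Y →L[ℂ] Y) : Norm (PQuotient P) :=
  (Submodule.Quotient.seminormedAddCommGroup (pCompactIdeal P)).toNorm

/-- The coset map `A ↦ A + K(Y, P)`. -/
def PQuotient.mk (P : ℕ → Y →L[ℂ] Y) : pAlgebra P →ₐ[ℂ] PQuotient P :=
  Ideal.Quotient.mkₐ ℂ (pCompactIdeal P)

/-- The norm of the coset `A + K(Y, P)` is the infimum of `‖A + K‖` over all `P`-compact `K`. -/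
theorem PQuotient.norm_mk_lt_iff (P : ℕ → Y →L[ℂ] Y) (A : pAlgebra P) (c : ℝ) :
    ‖PQuotient.mk P A‖ < c ↔
      ∃ K : Y →L[ℂ] Y, IsPCompact P K ∧ ‖(A : Y →L[ℂ] Y) + K‖ < c := by
  have key : ‖PQuotient.mk P A‖ < c ↔ ∃ m : pAlgebra P,
      (Ideal.Quotient.mk (pCompactIdeal P) m = Ideal.Quotient.mk (pCompactIdeal P) A) ∧ ‖m‖ < c :=
    QuotientAddGroup.norm_lt_iff (S := (pCompactIdeal P).toAddSubgroup)
  rw [key]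
  constructor
  · rintro ⟨m, hm, hlt⟩
    have h0 : m - A ∈ pCompactIdeal P := (Ideal.Quotient.mk_eq_mk_iff_sub_mem m A).1 hm
    have h1 : IsPCompact P ((m - A : pAlgebra P) : Y →L[ℂ] Y) := h0
    refine ⟨_, h1, ?_⟩
    have h2 : (A : Y →L[ℂ] Y) + ((m - A : pAlgebra P) : Y →L[ℂ] Y) = m :=
      add_sub_cancel (A : Y →L[ℂ] Y) m
    rw [h2]
    exact hlt
  · rintro ⟨K, hK, h⟩
    obtain ⟨L, rfl⟩ : ∃ L : pAlgebra P, (L : Y →L[ℂ] Y) = K := ⟨⟨K, hK.mem_pAlgebra⟩, rfl⟩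
    rw [← Subalgebra.coe_add] at h
    refine ⟨A + L, (Ideal.Quotient.mk_eq_mk_iff_sub_mem _ _).2 ?_, h⟩
    rw [add_sub_cancel_left]
    exact hK

/-- The `P`-essential `ε`-pseudospectrum of `A ∈ L(Y, P)`: the `ε`-pseudospectrum of the coset
`A + K(Y, P)` in the quotient algebra `L(Y, P) / K(Y, P)`. -/
def essPseudospectrum (P : ℕ → Y →L[ℂ] Y) (ε : ℝ) (A : pAlgebra P) : Set ℂ :=
  epsPseudospectrum ε (PQuotient.mk P A)

/-- `P`-strong convergence of a sequence of bounded linear operators. -/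
def PTendsto (P : ℕ → Y →L[ℂ] Y) (A : ℕ → Y →L[ℂ] Y) (B : Y →L[ℂ] Y) : Prop :=
  ∀ K, IsPCompact P K →
    Tendsto (fun n => ‖K * (A n - B)‖ + ‖(A n - B) * K‖) atTop (𝓝 0)

end PNotions

/-! ### The sequence spaces `l^p(ℤ^N, E)`, `p ∈ {0} ∪ [1, ∞]` -/

section Spaces

variable {N : ℕ} {p : ℝ≥0∞} {E : Type*} [NormedAddCommGroup E]

/-- The exponent of the norm: the usual `p`-norm for `p ≥ 1`, the supremum norm for `p = 0`. -/
def normExp (p : ℝ≥0∞) : ℝ≥0∞ := if p = 0 then ∞ else p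

instance normExp_fact [hp : Fact (p = 0 ∨ 1 ≤ p)] : Fact (1 ≤ normExp p) := ⟨by
  unfold normExp
  split_ifs with h
  · exact le_top
  · exact hp.out.resolve_left h⟩

theorem normExp_ne_zero (p : ℝ≥0∞) : normExp p ≠ 0 := by
  unfold normExp
  split_ifs with h
  · simp
  · exact h

/-- The ambient space: sequences `ℤ^N → E` with finite `normExp p`-norm. -/
abbrev AmbientSeq (N : ℕ) (p : ℝ≥0∞) (E : Type*) [NormedAddCommGroup E] : Type _ :=
  lp (fun _ : Fin N → ℤ => E) (normExp p)

theorem memℓp_indicator {ι : Type*} {q : ℝ≥0∞} (S : Set ι) {x : ι → E}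
    (hx : Memℓp x q) : Memℓp (S.indicator x) q :=
  Memℓp.mono' hx fun i => norm_indicator_le_norm_self x i

theorem norm_lp_comp_equiv {ι : Type*} {q : ℝ≥0∞} (hq : q ≠ 0) (e : ι ≃ ι)
    (x y : lp (fun _ : ι => E) q) (h : ∀ i, y i = x (e i)) : ‖y‖ = ‖x‖ := by
  rcases q.trichotomy with rfl | rfl | hq'
  · exact absurd rfl hq
  · rw [lp.norm_eq_ciSup, lp.norm_eq_ciSup]
    simp only [h]
    exact e.iSup_comp (g := fun i => ‖x i‖)
  · rw [lp.norm_eq_tsum_rpow hq', lp.norm_eq_tsum_rpow hq']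
    simp only [h]
    rw [e.tsum_eq (fun i => ‖x i‖ ^ q.toReal)]

theorem memℓp_comp_equiv {ι : Type*} {q : ℝ≥0∞} (e : ι ≃ ι) {x : ι → E}
    (hx : Memℓp x q) : Memℓp (fun i => x (e i)) q := by
  rcases q.trichotomy with rfl | rfl | hq'
  · exact memℓp_zero (hx.finite_dsupport.preimage e.injective.injOn)
  · refine memℓp_infty ?_
    obtain ⟨C, hC⟩ := hx.bddAbove
    exact ⟨C, by rintro _ ⟨i, rfl⟩; exact hC ⟨e i, rfl⟩⟩
  · exact memℓp_gen ((e.summable_iff (f := fun i => ‖x i‖ ^ q.toReal)).2 (hx.summable hq'))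

variable [NormedSpace ℂ E] [Fact (p = 0 ∨ 1 ≤ p)]

variable (N p E) in
/-- The finitely supported sequences. -/
def finSuppSeq : Submodule ℂ (AmbientSeq N p E) where
  carrier := {x | {i | x i ≠ 0}.Finite}
  zero_mem' := by simp
  add_mem' := by
    intro x y hx hy
    refine (hx.union hy).subset fun i hi => ?_
    by_contra hcon
    simp only [Set.mem_union, Set.mem_ofPred_eq, not_or, not_not] at hcon
    exact hi (by simp [hcon.1, hcon.2])
  smul_mem' := by
    intro c x hx
    refine hx.subset fun i hi => ?_
    intro hcon
    exact hi (by simp [hcon])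

variable (N p E) in
/-- The space `l^p(ℤ^N, E)` as a subspace of the ambient space: everything if `p ≥ 1`, and the
closure of the finitely supported sequences in `l^∞(ℤ^N, E)` if `p = 0`. -/
def seqSubmodule : Submodule ℂ (AmbientSeq N p E) :=
  if p = 0 then (finSuppSeq N p E).topologicalClosure else ⊤

/-- The Banach space `l^p(ℤ^N, E)`, `p ∈ {0} ∪ [1, ∞]`. -/
def SeqSpace (N : ℕ) (p : ℝ≥0∞) (E : Type*) [NormedAddCommGroup E] [NormedSpace ℂ E]
    [Fact (p = 0 ∨ 1 ≤ p)] : Type _ :=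
  seqSubmodule N p E

instance : NormedAddCommGroup (SeqSpace N p E) :=
  inferInstanceAs (NormedAddCommGroup (seqSubmodule N p E))

instance : NormedSpace ℂ (SeqSpace N p E) :=
  inferInstanceAs (NormedSpace ℂ (seqSubmodule N p E))

instance [CompleteSpace E] : CompleteSpace (SeqSpace N p E) := by
  have h : IsClosed (seqSubmodule N p E : Set (AmbientSeq N p E)) := by
    unfold seqSubmodule
    split_ifs
    · exact Submodule.isClosed_topologicalClosure _
    · exact isClosed_univ
  exact h.completeSpace_coe

/-- The `i`-th entry of a sequence. -/
def entry (x : SeqSpace N p E) (i : Fin N → ℤ) : E := x.1 i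

/-- A bounded operator on the ambient space that preserves finite supports maps `l^p(ℤ^N, E)` to
itself. -/
theorem mapsTo_seqSubmodule (T : AmbientSeq N p E →L[ℂ] AmbientSeq N p E)
    (hT : ∀ x ∈ finSuppSeq N p E, T x ∈ finSuppSeq N p E) :
    ∀ x ∈ seqSubmodule N p E, T x ∈ seqSubmodule N p E := by
  intro x hx
  unfold seqSubmodule at *
  split_ifs at * with h
  · exact map_mem_closure T.continuous hx hT
  · trivial

/-- Multiplication by the characteristic function of `S`, on the ambient space. -/
def ambientCut (S : Set (Fin N → ℤ)) : AmbientSeq N p E →L[ℂ] AmbientSeq N p E :=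
  LinearMap.mkContinuous
    { toFun := fun x => ⟨S.indicator (x : (Fin N → ℤ) → E), memℓp_indicator S x.2⟩
      map_add' := fun x y => by
        ext i
        exact congrFun (Set.indicator_add S (x : (Fin N → ℤ) → E) (y : (Fin N → ℤ) → E)) i
      map_smul' := fun c x => by
        ext i
        exact congrFun (Set.indicator_const_smul S c (x : (Fin N → ℤ) → E)) i }
    1 (fun x => by
      rw [one_mul]
      exact lp.norm_mono (normExp_ne_zero p) fun i => norm_indicator_le_norm_self _ i)

/-- The operator `χ_S I` of multiplication by the characteristic function of `S`. -/
def cut (S : Set (Fin N → ℤ)) : SeqSpace N p E →L[ℂ] SeqSpace N p E :=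
  ContinuousLinearMap.restrict (p := seqSubmodule N p E) (q := seqSubmodule N p E) (ambientCut S) (mapsTo_seqSubmodule _ fun x hx => by
    refine Set.Finite.subset hx fun i hi => ?_
    intro h
    refine hi ?_
    change S.indicator (x : (Fin N → ℤ) → E) i = 0
    simp [h])

/-- The shift `(x_i) ↦ (x_{i - α})`, on the ambient space. -/
def ambientShift (α : Fin N → ℤ) : AmbientSeq N p E →L[ℂ] AmbientSeq N p E :=
  LinearMap.mkContinuous
    { toFun := fun x => ⟨fun i => x (i - α), memℓp_comp_equiv (Equiv.subRight α) x.2⟩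
      map_add' := fun x y => rfl
      map_smul' := fun c x => rfl }
    1 (fun x => by
      rw [one_mul]
      exact (norm_lp_comp_equiv (normExp_ne_zero p) (Equiv.subRight α) x _ fun i => rfl).le)

/-- The shift operator `V_α : (x_i) ↦ (x_{i - α})`. -/
def shift (α : Fin N → ℤ) : SeqSpace N p E →L[ℂ] SeqSpace N p E :=
  ContinuousLinearMap.restrict (p := seqSubmodule N p E) (ambientShift α) (mapsTo_seqSubmodule _ fun _ hx =>
    Set.Finite.preimage (f := fun i => i - α) sub_left_injective.injOn hx)

theorem entry_cut (S : Set (Fin N → ℤ)) (x : SeqSpace N p E) (i : Fin N → ℤ) :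
    entry (cut S x) i = S.indicator (entry x) i := rfl

theorem entry_shift (α : Fin N → ℤ) (x : SeqSpace N p E) (i : Fin N → ℤ) :
    entry (shift α x) i = entry x (i - α) := rfl

variable (N p E) in
/-- The canonical projections `P_n = χ_{{-n, …, n}^N} I`. -/
def canonProj (n : ℕ) : SeqSpace N p E →L[ℂ] SeqSpace N p E :=
  cut {i | ∀ j, |i j| ≤ (n : ℤ)}

/-- `A` is a band operator: a finite sum `∑ a_α V_α` with multiplication operators `a_α I`,
`a_α ∈ l^∞(ℤ^N, L(E))`. -/
def IsBandOperator (A : SeqSpace N p E →L[ℂ] SeqSpace N p E) : Prop :=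
  ∃ (S : Finset (Fin N → ℤ)) (a : (Fin N → ℤ) → (Fin N → ℤ) → E →L[ℂ] E),
    (∀ α ∈ S, BddAbove (Set.range fun i => ‖a α i‖)) ∧
      ∀ x i, entry (A x) i = ∑ α ∈ S, a α i (entry (shift α x) i)

/-- `A` is band-dominated: it is in the operator norm closure of the band operators. -/
def IsBandDominated (A : SeqSpace N p E →L[ℂ] SeqSpace N p E) : Prop :=
  A ∈ closure {B : SeqSpace N p E →L[ℂ] SeqSpace N p E | IsBandOperator B}

/-- The sequence `h` in `ℤ^N` tends to infinity. -/
def TendsToInfinity (h : ℕ → Fin N → ℤ) : Prop :=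
  Tendsto (fun n => ‖h n‖) atTop atTop

/-- `B` is the limit operator of `A` with respect to `h`: the `P`-strong limit of
`V_{-h_n} A V_{h_n}`. -/
def IsLimitOperator (A : SeqSpace N p E →L[ℂ] SeqSpace N p E) (h : ℕ → Fin N → ℤ)
    (B : SeqSpace N p E →L[ℂ] SeqSpace N p E) : Prop :=
  PTendsto (canonProj N p E) (fun n => shift (-h n) * A * shift (h n)) B

/-- The operator spectrum: the set of all limit operators of `A`. -/
def opSpectrum (A : SeqSpace N p E →L[ℂ] SeqSpace N p E) :
    Set (SeqSpace N p E →L[ℂ] SeqSpace N p E) :=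
  {B | ∃ h, TendsToInfinity h ∧ IsLimitOperator A h B}

/-- `A` is rich: every sequence tending to infinity has a subsequence with respect to which the
limit operator of `A` exists. -/
def IsRich (A : SeqSpace N p E →L[ℂ] SeqSpace N p E) : Prop :=
  ∀ h : ℕ → Fin N → ℤ, TendsToInfinity h →
    ∃ φ : ℕ → ℕ, StrictMono φ ∧ ∃ B, IsLimitOperator A (h ∘ φ) B

end Spaces

end

noncomputable section

namespace SeqSpace

variable {N : ℕ} {p : ℝ≥0∞} {E : Type*} [NormedAddCommGroup E] [NormedSpace ℂ E]
  [Fact (p = 0 ∨ 1 ≤ p)]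

/-! ### Entries and norms -/

/-! After replacing `A` by `A - z` and negating both sides, the theorem says: for `c = 1/ε`, the
coset of `A` is invertible with inverse of norm at most `c` if and only if every limit operator of
`A` is invertible with inverse of norm at most `c`. The driving fact is that a band-dominated
operator almost commutes with multiplication by a slowly varying function, uniformly in the centre
of that function.

From the coset to the limit operators (`IsLimitOperator.exists_inverse`): for `t > c` the inverse
coset has a representative `B` with `‖B‖ ≤ t`. The conjugates `V_{-h_n} B V_{h_n}` need not converge
for a reason internal to `B`. But they invert the conjugates of `A` ever more accurately on fixed
boxes, and those converge and almost commute with wide cut-offs, so the conjugates of `B` are Cauchy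
on every box. Their limit `C` inverts the limit operator, and `‖C‖ ≤ t`; let `t` decrease to `c`.

From the limit operators to the coset: richness turns the bound on all limit operators into local
inverses of norm at most `c` on boxes of any prescribed size, far enough out
(`exists_local_inverse`). They are used twice. Glued over a grid of cubes they give a right inverse
modulo `P`-compact operators (`exists_right_parametrix`), but with a norm worse by the overlap
factor `7 ^ N`. They also bound `A` below by almost `1/c` on sequences supported near one point far
out. Since the norm of `x` is, up to an exact constant, the norm of the family of norms of its
localized pieces, this bound extends without loss to all sequences vanishing on a large box
(`exists_lower_bound_off_box`). The lower bound makes the right inverse `B` two-sided, because `A (B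
A - 1)` is `P`-compact, and it gives the sharp norm, because `A B` is `1` modulo `P`-compact
operators. No duality is involved, so all `p` are covered at once. -/

theorem ext {x y : SeqSpace N p E} (h : ∀ i, entry x i = entry y i) : x = y :=
  Subtype.ext (lp.ext (funext h))

@[simp] theorem entry_zero (i : Fin N → ℤ) : entry (0 : SeqSpace N p E) i = 0 := rfl

@[simp] theorem entry_add (x y : SeqSpace N p E) (i : Fin N → ℤ) :
    entry (x + y) i = entry x i + entry y i := rfl

@[simp] theorem entry_sub (x y : SeqSpace N p E) (i : Fin N → ℤ) :
    entry (x - y) i = entry x i - entry y i := rfl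

@[simp] theorem entry_smul (c : ℂ) (x : SeqSpace N p E) (i : Fin N → ℤ) :
    entry (c • x) i = c • entry x i := rfl

/-- The evaluation of a sequence at `i`, as a linear map. -/
def entryₗ (i : Fin N → ℤ) : SeqSpace N p E →ₗ[ℂ] E where
  toFun x := entry x i
  map_add' _ _ := rfl
  map_smul' _ _ := rfl

@[simp] theorem entry_sum {κ : Type*} (s : Finset κ) (x : κ → SeqSpace N p E) (i : Fin N → ℤ) :
    entry (∑ k ∈ s, x k) i = ∑ k ∈ s, entry (x k) i :=
  map_sum (entryₗ (p := p) (E := E) i) x s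

theorem norm_entry_le (x : SeqSpace N p E) (i : Fin N → ℤ) : ‖entry x i‖ ≤ ‖x‖ :=
  lp.norm_apply_le_norm (normExp_ne_zero p) x.1 i

theorem norm_mono {x y : SeqSpace N p E} (h : ∀ i, ‖entry x i‖ ≤ ‖entry y i‖) : ‖x‖ ≤ ‖y‖ :=
  lp.norm_mono (normExp_ne_zero p) h

theorem continuous_entry (i : Fin N → ℤ) : Continuous fun x : SeqSpace N p E => entry x i :=
  AddMonoidHomClass.continuous_of_bound (entryₗ (p := p) (E := E) i) 1
    fun x => by rw [one_mul]; exact norm_entry_le x i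

theorem memℓp_entry (x : SeqSpace N p E) : Memℓp (entry x) (normExp p) := x.1.2

/-- The real sequence of the norms of the entries. -/
def normSeq (x : SeqSpace N p E) : lp (fun _ : Fin N → ℤ => ℝ) (normExp p) :=
  ⟨fun i => ‖entry x i‖, memℓp_norm_iff.2 (memℓp_entry x)⟩

theorem normSeq_apply (x : SeqSpace N p E) (i : Fin N → ℤ) : normSeq x i = ‖entry x i‖ := rfl

theorem norm_normSeq (x : SeqSpace N p E) : ‖normSeq x‖ = ‖x‖ := by
  refine le_antisymm (lp.norm_mono (normExp_ne_zero p) fun i => ?_)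
    (lp.norm_mono (normExp_ne_zero p) fun i => ?_)
  · rw [normSeq_apply, norm_norm]; rfl
  · rw [normSeq_apply, norm_norm]; rfl

/-- The translate of a real `lp` sequence. -/
def lpShift {q : ℝ≥0∞} (α : Fin N → ℤ) (u : lp (fun _ : Fin N → ℤ => ℝ) q) :
    lp (fun _ : Fin N → ℤ => ℝ) q :=
  ⟨fun i => u (i - α), memℓp_comp_equiv (Equiv.subRight α) u.2⟩

theorem norm_lpShift {q : ℝ≥0∞} (hq : q ≠ 0) (α : Fin N → ℤ)
    (u : lp (fun _ : Fin N → ℤ => ℝ) q) : ‖lpShift α u‖ = ‖u‖ :=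
  norm_lp_comp_equiv hq (Equiv.subRight α) u _ fun _ => rfl

/-- Domination of a real sequence by a finite combination of translates of another one. -/
theorem lp_norm_le_of_le_sum_shift (S : Finset (Fin N → ℤ)) (c : (Fin N → ℤ) → ℝ)
    (hc : ∀ α ∈ S, 0 ≤ c α) (u v : lp (fun _ : Fin N → ℤ => ℝ) (normExp p))
    (h : ∀ i, ‖v i‖ ≤ ∑ α ∈ S, c α * u (i - α)) : ‖v‖ ≤ (∑ α ∈ S, c α) * ‖u‖ := by
  have hle : ‖v‖ ≤ ‖∑ α ∈ S, c α • lpShift α u‖ := by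
    refine lp.norm_mono (normExp_ne_zero p) fun i => (h i).trans ?_
    rw [lp.coeFn_sum, Finset.sum_apply]
    exact le_abs_self _
  refine hle.trans ((norm_sum_le _ _).trans ?_)
  rw [Finset.sum_mul]
  refine Finset.sum_le_sum fun α hα => ?_
  rw [norm_smul, Real.norm_of_nonneg (hc α hα), norm_lpShift (normExp_ne_zero p)]

theorem norm_le_of_entry_le_sum_shift (S : Finset (Fin N → ℤ)) (c : (Fin N → ℤ) → ℝ)
    (hc : ∀ α ∈ S, 0 ≤ c α) (x y : SeqSpace N p E)
    (h : ∀ i, ‖entry y i‖ ≤ ∑ α ∈ S, c α * ‖entry x (i - α)‖) :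
    ‖y‖ ≤ (∑ α ∈ S, c α) * ‖x‖ := by
  rw [← norm_normSeq x, ← norm_normSeq y]
  refine lp_norm_le_of_le_sum_shift S c hc _ _ fun i => ?_
  rw [normSeq_apply, norm_norm]
  exact h i

/-! ### Multiplication by scalar functions -/

theorem memℓp_smul_of_le_one {q : ℝ≥0∞} {f : (Fin N → ℤ) → ℝ} (hf : ∀ i, |f i| ≤ 1)
    {x : (Fin N → ℤ) → E} (hx : Memℓp x q) : Memℓp (fun i => (f i : ℂ) • x i) q :=
  Memℓp.mono' hx fun i => by
    rw [norm_smul, Complex.norm_real]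
    exact mul_le_of_le_one_left (norm_nonneg _) (hf i)

/-- Multiplication by a scalar function bounded by `1`, on the ambient space. -/
def ambientScalar (f : (Fin N → ℤ) → ℝ) (hf : ∀ i, |f i| ≤ 1) :
    AmbientSeq N p E →L[ℂ] AmbientSeq N p E :=
  LinearMap.mkContinuous
    { toFun := fun x => ⟨fun i => (f i : ℂ) • x i, memℓp_smul_of_le_one hf x.2⟩
      map_add' := fun x y => by ext i; exact smul_add _ _ _
      map_smul' := fun c x => by ext i; exact smul_comm _ _ _ }
    1 (fun x => by
      rw [one_mul]
      refine lp.norm_mono (normExp_ne_zero p) fun i => ?_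
      change ‖(f i : ℂ) • x i‖ ≤ _
      rw [norm_smul, Complex.norm_real]
      exact mul_le_of_le_one_left (norm_nonneg _) (hf i))

/-- Multiplication by a scalar function bounded by `1`. -/
def scalarOp (f : (Fin N → ℤ) → ℝ) (hf : ∀ i, |f i| ≤ 1) : SeqSpace N p E →L[ℂ] SeqSpace N p E :=
  ContinuousLinearMap.restrict (p := seqSubmodule N p E) (q := seqSubmodule N p E)
    (ambientScalar f hf) (mapsTo_seqSubmodule _ fun x hx => by
      refine Set.Finite.subset hx fun i hi => ?_
      intro h
      refine hi ?_
      change (f i : ℂ) • x i = 0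
      rw [h, smul_zero])

theorem entry_scalarOp (f : (Fin N → ℤ) → ℝ) (hf : ∀ i, |f i| ≤ 1) (x : SeqSpace N p E)
    (i : Fin N → ℤ) : entry (scalarOp f hf x) i = (f i : ℂ) • entry x i := rfl

theorem norm_entry_scalarOp (f : (Fin N → ℤ) → ℝ) (hf : ∀ i, |f i| ≤ 1) (x : SeqSpace N p E)
    (i : Fin N → ℤ) : ‖entry (scalarOp f hf x) i‖ = |f i| * ‖entry x i‖ := by
  rw [entry_scalarOp, norm_smul, Complex.norm_real, Real.norm_eq_abs]

theorem norm_scalarOp_le (f : (Fin N → ℤ) → ℝ) (hf : ∀ i, |f i| ≤ 1) :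
    ‖(scalarOp f hf : SeqSpace N p E →L[ℂ] SeqSpace N p E)‖ ≤ 1 :=
  ContinuousLinearMap.opNorm_le_bound _ zero_le_one fun x => by
    rw [one_mul]
    refine norm_mono fun i => ?_
    rw [norm_entry_scalarOp]
    exact mul_le_of_le_one_left (norm_nonneg _) (hf i)

/-! ### Cut-offs and shifts -/

theorem entry_cut_of_mem {S : Set (Fin N → ℤ)} {i : Fin N → ℤ} (h : i ∈ S) (x : SeqSpace N p E) :
    entry (cut S x) i = entry x i := by
  rw [entry_cut, Set.indicator_of_mem h]

theorem entry_cut_of_notMem {S : Set (Fin N → ℤ)} {i : Fin N → ℤ} (h : i ∉ S)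
    (x : SeqSpace N p E) : entry (cut S x) i = 0 := by
  rw [entry_cut, Set.indicator_of_notMem h]

theorem norm_cut_apply_le (S : Set (Fin N → ℤ)) (x : SeqSpace N p E) : ‖cut S x‖ ≤ ‖x‖ :=
  norm_mono fun i => by rw [entry_cut]; exact norm_indicator_le_norm_self _ i

theorem norm_cut_le (S : Set (Fin N → ℤ)) :
    ‖(cut S : SeqSpace N p E →L[ℂ] SeqSpace N p E)‖ ≤ 1 :=
  ContinuousLinearMap.opNorm_le_bound _ zero_le_one fun x => by
    rw [one_mul]; exact norm_cut_apply_le S x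

theorem cut_mul_cut (S T : Set (Fin N → ℤ)) :
    (cut S * cut T : SeqSpace N p E →L[ℂ] SeqSpace N p E) = cut (S ∩ T) := by
  ext x : 1
  refine ext fun i => ?_
  change entry (cut S (cut T x)) i = _
  rw [entry_cut, entry_cut, ← Set.indicator_indicator]
  congr 1

theorem one_sub_cut (S : Set (Fin N → ℤ)) :
    (1 - cut S : SeqSpace N p E →L[ℂ] SeqSpace N p E) = cut Sᶜ := by
  ext x : 1
  refine ext fun i => ?_
  change entry (x - cut S x) i = _
  by_cases h : i ∈ S
  · rw [entry_sub, entry_cut_of_mem h, entry_cut_of_notMem (Set.notMem_compl_iff.2 h), sub_self]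
  · rw [entry_sub, entry_cut_of_notMem h, entry_cut_of_mem h, sub_zero]

theorem cut_empty : (cut ∅ : SeqSpace N p E →L[ℂ] SeqSpace N p E) = 0 := by
  ext x : 1
  exact ext fun i => entry_cut_of_notMem (Set.notMem_empty i) x

theorem cut_apply_eq_self {S : Set (Fin N → ℤ)} {x : SeqSpace N p E}
    (h : ∀ i ∉ S, entry x i = 0) : cut S x = x :=
  ext fun i => by
    by_cases hi : i ∈ S
    · exact entry_cut_of_mem hi x
    · rw [entry_cut_of_notMem hi, h i hi]

theorem shift_mul_shift (α β : Fin N → ℤ) :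
    (shift α * shift β : SeqSpace N p E →L[ℂ] SeqSpace N p E) = shift (α + β) := by
  ext x : 1
  refine ext fun i => ?_
  change entry (shift α (shift β x)) i = _
  rw [entry_shift, entry_shift, entry_shift, sub_sub]

theorem shift_zero : (shift 0 : SeqSpace N p E →L[ℂ] SeqSpace N p E) = 1 := by
  ext x : 1
  exact ext fun i => by rw [entry_shift, sub_zero]; rfl

theorem shift_neg_mul_shift (α : Fin N → ℤ) :
    (shift (-α) * shift α : SeqSpace N p E →L[ℂ] SeqSpace N p E) = 1 := by
  rw [shift_mul_shift, neg_add_cancel, shift_zero]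

theorem shift_mul_shift_neg (α : Fin N → ℤ) :
    (shift α * shift (-α) : SeqSpace N p E →L[ℂ] SeqSpace N p E) = 1 := by
  rw [shift_mul_shift, add_neg_cancel, shift_zero]

theorem norm_shift_le (α : Fin N → ℤ) :
    ‖(shift α : SeqSpace N p E →L[ℂ] SeqSpace N p E)‖ ≤ 1 :=
  ContinuousLinearMap.opNorm_le_bound _ zero_le_one fun x => by
    rw [one_mul]
    exact (norm_lp_comp_equiv (normExp_ne_zero p) (Equiv.subRight α) x.1 (shift α x).1
      fun i => rfl).le

/-- The conjugate `V_{-α} A V_α`. -/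
def conj (α : Fin N → ℤ) (A : SeqSpace N p E →L[ℂ] SeqSpace N p E) :
    SeqSpace N p E →L[ℂ] SeqSpace N p E :=
  shift (-α) * A * shift α

theorem conj_mul (α : Fin N → ℤ) (A B : SeqSpace N p E →L[ℂ] SeqSpace N p E) :
    conj α (A * B) = conj α A * conj α B := by
  unfold conj
  calc _ = shift (-α) * A * 1 * B * shift α := by noncomm_ring
    _ = _ := by rw [← shift_mul_shift_neg α]; noncomm_ring

theorem conj_sub (α : Fin N → ℤ) (A B : SeqSpace N p E →L[ℂ] SeqSpace N p E) :
    conj α (A - B) = conj α A - conj α B := by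
  unfold conj; noncomm_ring

theorem conj_one (α : Fin N → ℤ) : conj α (1 : SeqSpace N p E →L[ℂ] SeqSpace N p E) = 1 := by
  unfold conj; rw [mul_one, shift_neg_mul_shift]

theorem conj_smul (α : Fin N → ℤ) (c : ℂ) (A : SeqSpace N p E →L[ℂ] SeqSpace N p E) :
    conj α (c • A) = c • conj α A := by
  unfold conj; rw [mul_smul_comm, smul_mul_assoc]

theorem norm_conj_le (α : Fin N → ℤ) (A : SeqSpace N p E →L[ℂ] SeqSpace N p E) :
    ‖conj α A‖ ≤ ‖A‖ := by
  unfold conj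
  refine (norm_mul_le _ _).trans ?_
  refine (mul_le_of_le_one_right (norm_nonneg _) (norm_shift_le α)).trans ?_
  refine (norm_mul_le _ _).trans ?_
  exact mul_le_of_le_one_left (norm_nonneg _) (norm_shift_le _)

theorem conj_neg_conj (α : Fin N → ℤ) (A : SeqSpace N p E →L[ℂ] SeqSpace N p E) :
    conj (-α) (conj α A) = A := by
  unfold conj
  calc _ = (shift (- -α) * shift (-α)) * A * (shift α * shift (-α)) := by noncomm_ring
    _ = A := by rw [shift_neg_mul_shift, shift_mul_shift_neg, one_mul, mul_one]

/-! ### Boxes -/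

/-- The closed box of radius `R` around `k`. -/
def box (k : Fin N → ℤ) (R : ℝ) : Set (Fin N → ℤ) := {i | ‖i - k‖ ≤ R}

theorem mem_box {k i : Fin N → ℤ} {R : ℝ} : i ∈ box k R ↔ ‖i - k‖ ≤ R := Iff.rfl

theorem finite_box (k : Fin N → ℤ) (R : ℝ) : (box k R).Finite := by
  have h : box k R = Metric.closedBall k R := by
    ext i; rw [mem_box, Metric.mem_closedBall, dist_eq_norm]
  rw [h]
  exact (isCompact_closedBall k R).finite_of_discrete

theorem canonProj_eq (n : ℕ) :
    (canonProj N p E n) = cut (box 0 n) := by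
  unfold canonProj
  congr 1
  ext i
  rw [mem_box, sub_zero, pi_norm_le_iff_of_nonneg (Nat.cast_nonneg n), Set.mem_ofPred_eq]
  refine forall_congr' fun j => ?_
  rw [Int.norm_eq_abs, ← Int.cast_abs]
  exact_mod_cast Iff.rfl

theorem conj_cut (α : Fin N → ℤ) (S : Set (Fin N → ℤ)) :
    conj α (cut S : SeqSpace N p E →L[ℂ] SeqSpace N p E) = cut {i | i + α ∈ S} := by
  ext x : 1
  refine ext fun i => ?_
  change entry (shift (-α) (cut S (shift α x))) i = _
  rw [entry_shift, sub_neg_eq_add]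
  by_cases h : i + α ∈ S
  · rw [entry_cut_of_mem h, entry_shift, entry_cut_of_mem (S := {i | i + α ∈ S}) h,
      add_sub_cancel_right]
  · rw [entry_cut_of_notMem h, entry_cut_of_notMem (S := {i | i + α ∈ S}) h]

theorem conj_cut_box (α k : Fin N → ℤ) (R : ℝ) :
    conj α (cut (box (k + α) R) : SeqSpace N p E →L[ℂ] SeqSpace N p E) = cut (box k R) := by
  rw [conj_cut]
  congr 1
  ext i
  simp only [box, Set.mem_ofPred_eq, add_sub_add_right_eq_sub]

theorem conj_scalarOp (α : Fin N → ℤ) (f : (Fin N → ℤ) → ℝ) (hf : ∀ i, |f i| ≤ 1) :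
    conj α (scalarOp f hf : SeqSpace N p E →L[ℂ] SeqSpace N p E) =
      scalarOp (fun i => f (i + α)) fun _ => hf _ := by
  ext x : 1
  refine ext fun i => ?_
  change entry (shift (-α) (scalarOp f hf (shift α x))) i = _
  rw [entry_shift, sub_neg_eq_add, entry_scalarOp, entry_scalarOp, entry_shift,
    add_sub_cancel_right]

/-! ### Trapezoidal functions -/

/-- The function that is `1` on the box of radius `r`, `0` off the box of radius `2 r`, and has
Lipschitz constant `1 / r`. -/
def trap (r : ℝ) (i : Fin N → ℤ) : ℝ := max 0 (min 1 (2 - ‖i‖ / r))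

theorem trap_nonneg (r : ℝ) (i : Fin N → ℤ) : 0 ≤ trap r i := le_max_left _ _

theorem trap_le_one (r : ℝ) (i : Fin N → ℤ) : trap r i ≤ 1 :=
  max_le zero_le_one (min_le_left _ _)

theorem abs_trap_le (r : ℝ) (i : Fin N → ℤ) : |trap r i| ≤ 1 := by
  rw [abs_of_nonneg (trap_nonneg r i)]; exact trap_le_one r i

theorem trap_eq_one {r : ℝ} (hr : 0 < r) {i : Fin N → ℤ} (h : ‖i‖ ≤ r) : trap r i = 1 := by
  have : ‖i‖ / r ≤ 1 := (div_le_one hr).2 h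
  unfold trap
  rw [min_eq_left (by linarith), max_eq_right zero_le_one]

theorem trap_eq_zero {r : ℝ} (hr : 0 < r) {i : Fin N → ℤ} (h : 2 * r ≤ ‖i‖) : trap r i = 0 := by
  have : 2 ≤ ‖i‖ / r := (le_div_iff₀ hr).2 h
  unfold trap
  exact max_eq_left ((min_le_right _ _).trans (by linarith))

theorem abs_trap_sub_le {r : ℝ} (hr : 0 < r) (i j : Fin N → ℤ) :
    |trap r i - trap r j| ≤ ‖i - j‖ / r := by
  unfold trap
  refine (abs_max_sub_max_le_max _ _ _ _).trans (max_le (by simp; positivity) ?_)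
  refine (abs_min_sub_min_le_max _ _ _ _).trans (max_le (by simp; positivity) ?_)
  rw [sub_sub_sub_cancel_left, ← sub_div, abs_div, abs_of_pos hr, norm_sub_rev]
  gcongr
  exact abs_norm_sub_norm_le j i

variable (p E) in
/-- Multiplication by the trapezoidal function centred at `k`. -/
def trapOp (r : ℝ) (k : Fin N → ℤ) : SeqSpace N p E →L[ℂ] SeqSpace N p E :=
  scalarOp (fun i => trap r (i - k)) fun _ => abs_trap_le r _

theorem entry_trapOp (r : ℝ) (k : Fin N → ℤ) (x : SeqSpace N p E) (i : Fin N → ℤ) :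
    entry (trapOp p E r k x) i = (trap r (i - k) : ℂ) • entry x i := rfl

theorem norm_entry_trapOp (r : ℝ) (k : Fin N → ℤ) (x : SeqSpace N p E) (i : Fin N → ℤ) :
    ‖entry (trapOp p E r k x) i‖ = trap r (i - k) * ‖entry x i‖ := by
  rw [trapOp, norm_entry_scalarOp, abs_of_nonneg (trap_nonneg _ _)]

theorem norm_trapOp_le (r : ℝ) (k : Fin N → ℤ) : ‖trapOp p E r k‖ ≤ 1 := norm_scalarOp_le _ _

theorem conj_trapOp (α k : Fin N → ℤ) (r : ℝ) :
    conj α (trapOp p E r (k + α)) = trapOp p E r k := by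
  unfold trapOp
  rw [conj_scalarOp]
  simp only [add_sub_add_right_eq_sub]

theorem cut_mul_trapOp_of_subset {r : ℝ} (hr : 0 < r) {k : Fin N → ℤ} {S : Set (Fin N → ℤ)}
    (hS : box k (2 * r) ⊆ S) : cut S * trapOp p E r k = trapOp p E r k := by
  ext x : 1
  refine cut_apply_eq_self (x := trapOp p E r k x) fun i hi => ?_
  have : ¬ ‖i - k‖ ≤ 2 * r := fun h => hi (hS h)
  rw [entry_trapOp, trap_eq_zero hr (not_le.1 this).le, Complex.ofReal_zero, zero_smul]

theorem cut_mul_scalarOp (S : Set (Fin N → ℤ)) (f : (Fin N → ℤ) → ℝ) (hf : ∀ i, |f i| ≤ 1) :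
    (cut S * scalarOp f hf : SeqSpace N p E →L[ℂ] SeqSpace N p E) = scalarOp f hf * cut S := by
  ext x : 1
  refine ext fun i => ?_
  change entry (cut S (scalarOp f hf x)) i = entry (scalarOp f hf (cut S x)) i
  by_cases hi : i ∈ S
  · rw [entry_cut_of_mem hi, entry_scalarOp, entry_scalarOp, entry_cut_of_mem hi]
  · rw [entry_cut_of_notMem hi, entry_scalarOp, entry_cut_of_notMem hi, smul_zero]

theorem cut_mul_trapOp (S : Set (Fin N → ℤ)) (r : ℝ) (k : Fin N → ℤ) :
    cut S * trapOp p E r k = trapOp p E r k * cut S :=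
  cut_mul_scalarOp _ _ _

theorem trapOp_mul_cut_of_subset {r : ℝ} (hr : 0 < r) {k : Fin N → ℤ} {S : Set (Fin N → ℤ)}
    (hS : box k (2 * r) ⊆ S) : trapOp p E r k * cut S = trapOp p E r k := by
  rw [← cut_mul_trapOp, cut_mul_trapOp_of_subset hr hS]

theorem trapOp_mul_cut {r : ℝ} (hr : 0 < r) {k : Fin N → ℤ} {S : Set (Fin N → ℤ)}
    (hS : S ⊆ box k r) : trapOp p E r k * cut S = cut S := by
  ext x : 1
  refine ext fun i => ?_
  change entry (trapOp p E r k (cut S x)) i = _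
  rw [entry_trapOp]
  by_cases hi : i ∈ S
  · rw [trap_eq_one hr (hS hi), Complex.ofReal_one, one_smul]
  · rw [entry_cut_of_notMem hi, smul_zero]

theorem cut_mul_trapOp_eq_cut {r : ℝ} (hr : 0 < r) {k : Fin N → ℤ} {S : Set (Fin N → ℤ)}
    (hS : S ⊆ box k r) : cut S * trapOp p E r k = cut S := by
  rw [cut_mul_trapOp, trapOp_mul_cut hr hS]

/-! ### Finite propagation and commutators -/

/-- The `i`-th entry of `T x` depends only on the entries of `x` in the box of radius `w`
around `i`. -/
def HasPropagation (T : SeqSpace N p E →L[ℂ] SeqSpace N p E) (w : ℝ) : Prop :=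
  ∀ x i, (∀ j ∈ box i w, entry x j = 0) → entry (T x) i = 0

theorem HasPropagation.cut_mul_mul_cut_eq_zero {T : SeqSpace N p E →L[ℂ] SeqSpace N p E} {w : ℝ}
    (hT : HasPropagation T w) {S S' : Set (Fin N → ℤ)}
    (h : ∀ i ∈ S, ∀ j ∈ S', j ∉ box i w) : cut S * T * cut S' = 0 := by
  ext x : 1
  refine ext fun i => ?_
  change entry (cut S (T (cut S' x))) i = 0
  by_cases hi : i ∈ S
  · rw [entry_cut_of_mem hi]
    refine hT _ _ fun j hj => entry_cut_of_notMem (fun hj' => h i hi j hj' hj) _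
  · rw [entry_cut_of_notMem hi]

theorem norm_shift_index_le {S : Finset (Fin N → ℤ)} {α : Fin N → ℤ} (hα : α ∈ S) :
    ‖α‖ ≤ ∑ β ∈ S, ‖β‖ :=
  Finset.single_le_sum (f := fun β : Fin N → ℤ => ‖β‖) (fun _ _ => norm_nonneg _) hα

theorem _root_.IsBandOperator.exists_hasPropagation {A : SeqSpace N p E →L[ℂ] SeqSpace N p E}
    (hA : IsBandOperator A) : ∃ w : ℝ, 0 ≤ w ∧ HasPropagation A w := by
  obtain ⟨S, a, -, hA⟩ := hA
  refine ⟨∑ β ∈ S, ‖β‖, Finset.sum_nonneg fun _ _ => norm_nonneg _, fun x i hx => ?_⟩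
  rw [hA]
  refine Finset.sum_eq_zero fun α hα => ?_
  rw [entry_shift, hx (i - α), map_zero]
  rw [mem_box, sub_sub_cancel_left, norm_neg]
  exact norm_shift_index_le hα

/-- On the diagonal with index `α` the commutator multiplies `a α i` by the difference of two values
of the trapezoidal function at distance `‖α‖`, which is at most `‖α‖ / r`. The translates of the
function share one Lipschitz constant, so `κ` does not depend on `k`. -/
theorem _root_.IsBandOperator.exists_norm_commutator_le
    {A : SeqSpace N p E →L[ℂ] SeqSpace N p E} (hA : IsBandOperator A) :
    ∃ κ : ℝ, 0 ≤ κ ∧ ∀ r : ℝ, 0 < r → ∀ k,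
      ‖A * trapOp p E r k - trapOp p E r k * A‖ ≤ κ / r := by
  obtain ⟨S, a, hb, hA⟩ := hA
  have hC : ∀ α, ∃ C : ℝ, 0 ≤ C ∧ (α ∈ S → ∀ i, ‖a α i‖ ≤ C) := by
    intro α
    by_cases hα : α ∈ S
    · obtain ⟨C, hC⟩ := hb α hα
      exact ⟨max C 0, le_max_right _ _, fun _ i => (hC ⟨i, rfl⟩).trans (le_max_left _ _)⟩
    · exact ⟨0, le_rfl, fun h => absurd h hα⟩
  choose C hC0 hC using hC
  refine ⟨∑ α ∈ S, C α * ‖α‖, Finset.sum_nonneg fun α _ => mul_nonneg (hC0 α) (norm_nonneg _),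
    fun r hr k => ?_⟩
  refine ContinuousLinearMap.opNorm_le_bound _ (div_nonneg
    (Finset.sum_nonneg fun α _ => mul_nonneg (hC0 α) (norm_nonneg _)) hr.le) fun x => ?_
  rw [Finset.sum_div]
  refine norm_le_of_entry_le_sum_shift S (fun α => C α * ‖α‖ / r)
    (fun α _ => div_nonneg (mul_nonneg (hC0 α) (norm_nonneg _)) hr.le) x _ fun i => ?_
  change ‖entry (A (trapOp p E r k x) - trapOp p E r k (A x)) i‖ ≤ _
  rw [entry_sub, entry_trapOp, hA, hA, Finset.smul_sum, ← Finset.sum_sub_distrib]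
  refine norm_sum_le_of_le _ fun α hα => ?_
  rw [entry_shift, entry_shift, entry_trapOp, map_smul, ← sub_smul, norm_smul,
    ← Complex.ofReal_sub, Complex.norm_real, Real.norm_eq_abs]
  have h1 := abs_trap_sub_le hr (i - α - k) (i - k)
  have h2 : i - α - k - (i - k) = -α := by abel
  rw [h2, norm_neg] at h1
  calc _ ≤ ‖α‖ / r * (C α * ‖entry x (i - α)‖) := by
        gcongr
        exact (a α i).le_of_opNorm_le (hC α hα i) _
    _ = _ := by ring

theorem commutator_sub_le (A A' : SeqSpace N p E →L[ℂ] SeqSpace N p E) (r : ℝ)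
    (k : Fin N → ℤ) :
    ‖A * trapOp p E r k - trapOp p E r k * A‖ ≤
      ‖A' * trapOp p E r k - trapOp p E r k * A'‖ + 2 * ‖A - A'‖ := by
  have h1 : A * trapOp p E r k - trapOp p E r k * A =
      (A' * trapOp p E r k - trapOp p E r k * A') +
        ((A - A') * trapOp p E r k - trapOp p E r k * (A - A')) := by noncomm_ring
  have h2 : ‖(A - A') * trapOp p E r k‖ ≤ ‖A - A'‖ :=
    (norm_mul_le _ _).trans (mul_le_of_le_one_right (norm_nonneg _) (norm_trapOp_le _ _))
  have h3 : ‖trapOp p E r k * (A - A')‖ ≤ ‖A - A'‖ :=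
    (norm_mul_le _ _).trans (mul_le_of_le_one_left (norm_nonneg _) (norm_trapOp_le _ _))
  rw [h1]
  refine (norm_add_le _ _).trans ?_
  have := norm_sub_le ((A - A') * trapOp p E r k) (trapOp p E r k * (A - A'))
  linarith

theorem _root_.IsBandDominated.exists_band {A : SeqSpace N p E →L[ℂ] SeqSpace N p E}
    (hA : IsBandDominated A) {δ : ℝ} (hδ : 0 < δ) :
    ∃ A' : SeqSpace N p E →L[ℂ] SeqSpace N p E, IsBandOperator A' ∧ ‖A - A'‖ < δ := by
  obtain ⟨A', hA', h⟩ := Metric.mem_closure_iff.1 hA δ hδ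
  exact ⟨A', hA', by rwa [dist_eq_norm] at h⟩

theorem _root_.IsBandDominated.exists_commutator_le {A : SeqSpace N p E →L[ℂ] SeqSpace N p E}
    (hA : IsBandDominated A) {δ : ℝ} (hδ : 0 < δ) :
    ∃ r₀ : ℝ, 0 < r₀ ∧ ∀ r, r₀ ≤ r → ∀ k,
      ‖A * trapOp p E r k - trapOp p E r k * A‖ ≤ δ := by
  obtain ⟨A', hA', h⟩ := hA.exists_band (show 0 < δ / 4 by positivity)
  obtain ⟨κ, hκ, hκ'⟩ := hA'.exists_norm_commutator_le
  refine ⟨2 * κ / δ + 1, by positivity, fun r hr k => ?_⟩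
  have hr0 : 0 < r := lt_of_lt_of_le (by positivity) hr
  refine (commutator_sub_le A A' r k).trans ?_
  have h1 : κ / r ≤ δ / 2 := by
    rw [div_le_iff₀ hr0]
    have : 2 * κ / δ ≤ r := by linarith
    rw [div_le_iff₀ hδ] at this
    linarith
  linarith [hκ' r hr0 k]

theorem isBandOperator_sub_smul_one {A : SeqSpace N p E →L[ℂ] SeqSpace N p E}
    (hA : IsBandOperator A) (z : ℂ) : IsBandOperator (A - z • 1) := by
  obtain ⟨S, a, hb, hA⟩ := hA
  classical
  -- The index `0` may or may not lie in `S`; the first conditional discards the irrelevant value `a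
  -- 0` when it does not.
  refine ⟨insert 0 S, fun α i => (if α ∈ S then a α i else 0) - (if α = 0 then z • 1 else 0),
    fun α _ => ?_, fun x i => ?_⟩
  · by_cases hα : α ∈ S
    · obtain ⟨C, hC⟩ := hb α hα
      refine ⟨C + ‖(if α = 0 then z • (1 : E →L[ℂ] E) else 0)‖, ?_⟩
      rintro _ ⟨i, rfl⟩
      simp only [hα, if_true]
      exact (norm_sub_le _ _).trans (by gcongr; exact hC ⟨i, rfl⟩)
    · refine ⟨‖(if α = 0 then z • (1 : E →L[ℂ] E) else 0)‖, ?_⟩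
      rintro _ ⟨i, rfl⟩
      simp only [hα, if_false, zero_sub, norm_neg, le_refl]
  · change entry (A x - z • x) i = _
    simp only [sub_apply, Finset.sum_sub_distrib]
    rw [entry_sub, entry_smul, hA]
    congr 1
    · refine Finset.sum_subset_zero_on_sdiff (Finset.subset_insert _ _) (fun α hα => ?_)
        fun α hα => ?_
      · rw [if_neg (Finset.mem_sdiff.1 hα).2]; rfl
      · rw [if_pos hα]
    · rw [Finset.sum_eq_single_of_mem 0 (Finset.mem_insert_self _ _) fun α _ hα => by
        rw [if_neg hα]; rfl]
      rw [if_pos rfl, entry_shift, sub_zero]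
      rfl

theorem _root_.IsBandDominated.sub_smul_one {A : SeqSpace N p E →L[ℂ] SeqSpace N p E}
    (hA : IsBandDominated A) (z : ℂ) : IsBandDominated (A - z • 1) := by
  have hc : Continuous fun B : SeqSpace N p E →L[ℂ] SeqSpace N p E => B - z • 1 := by fun_prop
  exact map_mem_closure (f := fun B => B - z • 1) hc hA fun B hB =>
    isBandOperator_sub_smul_one hB z

/-! ### `P`-compact operators -/

theorem isPCompact_cut {S : Set (Fin N → ℤ)} (hS : S.Finite) :
    IsPCompact (canonProj N p E) (cut S) := by
  obtain ⟨C, hC⟩ : ∃ C : ℝ, ∀ i ∈ S, ‖i‖ ≤ C := by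
    obtain ⟨C, hC⟩ := (hS.image fun i => ‖i‖).bddAbove
    exact ⟨C, fun i hi => hC ⟨i, hi, rfl⟩⟩
  obtain ⟨m, hm⟩ := exists_nat_ge C
  have hsub : ∀ n ≥ m, S ⊆ box 0 n := fun n hn i hi => by
    rw [mem_box, sub_zero]
    exact (hC i hi).trans (hm.trans (by exact_mod_cast hn))
  rw [isPCompact_iff]
  have h1 : ∀ n ≥ m, (1 - canonProj N p E n) * cut S = 0 := fun n hn => by
    rw [canonProj_eq, one_sub_cut, cut_mul_cut, ← cut_empty]
    congr 1
    exact (Set.disjoint_compl_left_iff_subset.2 (hsub n hn)).inter_eq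
  have h2 : ∀ n ≥ m, cut S * (1 - canonProj N p E n) = 0 := fun n hn => by
    rw [canonProj_eq, one_sub_cut, cut_mul_cut, ← cut_empty]
    congr 1
    exact (Set.disjoint_compl_right_iff_subset.2 (hsub n hn)).inter_eq
  exact ⟨tendsto_const_nhds.congr' (eventually_atTop.2 ⟨m, fun n hn => (h1 n hn).symm⟩),
    tendsto_const_nhds.congr' (eventually_atTop.2 ⟨m, fun n hn => (h2 n hn).symm⟩)⟩

/-- The `P`-compact operators are norm closed because the `1 - P n` are uniformly bounded. -/
theorem isPCompact_of_closure {P : ℕ → SeqSpace N p E →L[ℂ] SeqSpace N p E}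
    (hP : ∀ n, ‖1 - P n‖ ≤ 1) {K : SeqSpace N p E →L[ℂ] SeqSpace N p E}
    (h : ∀ δ > 0, ∃ L, IsPCompact P L ∧ ‖K - L‖ ≤ δ) : IsPCompact P K := by
  rw [isPCompact_iff, NormedAddGroup.tendsto_nhds_zero, NormedAddGroup.tendsto_nhds_zero]
  have key : ∀ δ > 0, ∀ᶠ n in atTop, ‖(1 - P n) * K‖ < δ ∧ ‖K * (1 - P n)‖ < δ := by
    intro δ hδ
    obtain ⟨L, hL, hKL⟩ := h (δ / 2) (by positivity)
    rw [isPCompact_iff, NormedAddGroup.tendsto_nhds_zero,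
      NormedAddGroup.tendsto_nhds_zero] at hL
    filter_upwards [hL.1 (δ / 2) (by positivity), hL.2 (δ / 2) (by positivity)] with n h1 h2
    constructor
    · calc ‖(1 - P n) * K‖ = ‖(1 - P n) * L + (1 - P n) * (K - L)‖ := by
            congr 1; noncomm_ring
        _ ≤ ‖(1 - P n) * L‖ + ‖(1 - P n) * (K - L)‖ := norm_add_le _ _
        _ < δ / 2 + 1 * (δ / 2) := by
            refine add_lt_add_of_lt_of_le h1 ((norm_mul_le _ _).trans ?_)
            gcongr
            exact hP n
        _ = δ := by ring
    · calc ‖K * (1 - P n)‖ = ‖L * (1 - P n) + (K - L) * (1 - P n)‖ := by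
            congr 1; noncomm_ring
        _ ≤ ‖L * (1 - P n)‖ + ‖(K - L) * (1 - P n)‖ := norm_add_le _ _
        _ < δ / 2 + δ / 2 * 1 := by
            refine add_lt_add_of_lt_of_le h2 ((norm_mul_le _ _).trans ?_)
            gcongr
            exact hP n
        _ = δ := by ring
  exact ⟨fun δ hδ => (key δ hδ).mono fun n h => h.1, fun δ hδ => (key δ hδ).mono fun n h => h.2⟩

theorem norm_one_sub_canonProj_le (n : ℕ) : ‖1 - canonProj N p E n‖ ≤ 1 := by
  rw [canonProj_eq, one_sub_cut]; exact norm_cut_le _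

theorem isClosed_pAlgebra : IsClosed (pAlgebra (canonProj N p E) : Set
    (SeqSpace N p E →L[ℂ] SeqSpace N p E)) := by
  refine isClosed_of_closure_subset fun A hA K hK => ?_
  constructor
  · refine isPCompact_of_closure norm_one_sub_canonProj_le fun δ hδ => ?_
    obtain ⟨A', hA', h⟩ := Metric.mem_closure_iff.1 hA (δ / (‖K‖ + 1)) (by positivity)
    rw [dist_eq_norm] at h
    refine ⟨A' * K, (hA' K hK).1, ?_⟩
    rw [← sub_mul]
    refine (norm_mul_le _ _).trans ?_
    calc _ ≤ δ / (‖K‖ + 1) * (‖K‖ + 1) := by gcongr; linarith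
      _ = δ := div_mul_cancel₀ _ (by positivity)
  · refine isPCompact_of_closure norm_one_sub_canonProj_le fun δ hδ => ?_
    obtain ⟨A', hA', h⟩ := Metric.mem_closure_iff.1 hA (δ / (‖K‖ + 1)) (by positivity)
    rw [dist_eq_norm] at h
    refine ⟨K * A', (hA' K hK).2, ?_⟩
    rw [← mul_sub]
    refine (norm_mul_le _ _).trans ?_
    calc _ ≤ (‖K‖ + 1) * (δ / (‖K‖ + 1)) := by gcongr; linarith
      _ = δ := mul_div_cancel₀ _ (by positivity)

/-- Passing through `T` widens a box by at most `s ≥ w`, so the product of `1 - P_{n+s}`, `T` and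
`P_n` vanishes in either order. Decay of `K` at scale `n` therefore becomes decay of `T K` and `K T`
at scale `n + s`. -/
theorem HasPropagation.mem_pAlgebra {T : SeqSpace N p E →L[ℂ] SeqSpace N p E} {w : ℝ}
    (hT : HasPropagation T w) : T ∈ pAlgebra (canonProj N p E) := by
  obtain ⟨s, hs⟩ := exists_nat_ge w
  intro K hK
  rw [isPCompact_iff] at hK
  have hfar : ∀ n : ℕ, ∀ i ∈ (box 0 (n + s : ℕ) : Set (Fin N → ℤ))ᶜ, ∀ j ∈ box 0 (n : ℝ),
      ‖i - j‖ ≤ w → False := by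
    intro n i hi j hj hij
    rw [Set.mem_compl_iff, mem_box, sub_zero, not_le] at hi
    rw [mem_box, sub_zero] at hj
    have : ‖i‖ ≤ ‖i - j‖ + ‖j‖ := by simpa using norm_add_le (i - j) j
    push_cast at hi
    linarith
  rw [isPCompact_iff, isPCompact_iff]
  refine ⟨⟨?_, ?_⟩, ⟨?_, ?_⟩⟩
  · rw [← tendsto_add_atTop_iff_nat s]
    have hz : Tendsto (fun n => ‖T‖ * ‖(1 - canonProj N p E n) * K‖) atTop (𝓝 0) := by
      simpa using hK.1.norm.const_mul ‖T‖
    refine squeeze_zero_norm (fun n => ?_) hz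
    have h0 : (1 - canonProj N p E (n + s)) * T * canonProj N p E n = 0 := by
      rw [canonProj_eq, canonProj_eq, one_sub_cut]
      refine hT.cut_mul_mul_cut_eq_zero fun i hi j hj hij => hfar n i hi j hj ?_
      rw [norm_sub_rev]; exact hij
    have h1 : (1 - canonProj N p E (n + s)) * (T * K) =
        (1 - canonProj N p E (n + s)) * (T * ((1 - canonProj N p E n) * K)) +
          (1 - canonProj N p E (n + s)) * T * canonProj N p E n * K := by noncomm_ring
    rw [h1, h0, zero_mul, add_zero]
    refine (norm_mul_le _ _).trans ?_
    refine (mul_le_of_le_one_left (norm_nonneg _) (norm_one_sub_canonProj_le _)).trans ?_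
    exact norm_mul_le _ _
  · simpa [mul_assoc] using hK.2.const_mul T
  · simpa [mul_assoc] using hK.1.mul_const T
  · rw [← tendsto_add_atTop_iff_nat s]
    have hz : Tendsto (fun n => ‖K * (1 - canonProj N p E n)‖ * ‖T‖) atTop (𝓝 0) := by
      simpa using hK.2.norm.mul_const ‖T‖
    refine squeeze_zero_norm (fun n => ?_) hz
    have h0 : canonProj N p E n * T * (1 - canonProj N p E (n + s)) = 0 := by
      rw [canonProj_eq, canonProj_eq, one_sub_cut]
      exact hT.cut_mul_mul_cut_eq_zero fun i hi j hj hij => hfar n j hj i hi hij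
    have h1 : K * T * (1 - canonProj N p E (n + s)) =
        (K * (1 - canonProj N p E n)) * T * (1 - canonProj N p E (n + s)) +
          K * (canonProj N p E n * T * (1 - canonProj N p E (n + s))) := by noncomm_ring
    rw [h1, h0, mul_zero, add_zero]
    refine (norm_mul_le _ _).trans ?_
    refine (mul_le_of_le_one_right (norm_nonneg _) (norm_one_sub_canonProj_le _)).trans ?_
    exact norm_mul_le _ _

/-! ### Conjugates along sequences tending to infinity -/

theorem _root_.TendsToInfinity.eventually_box_subset {h : ℕ → Fin N → ℤ} (hh : TendsToInfinity h)
    (R m : ℝ) : ∀ᶠ n in atTop, box (h n) R ⊆ (box 0 m)ᶜ := by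
  filter_upwards [hh.eventually_gt_atTop (m + R)] with n hn i hi hi'
  rw [mem_box] at hi
  rw [mem_box, sub_zero] at hi'
  have : ‖h n‖ ≤ ‖i‖ + ‖i - h n‖ := by
    have := norm_sub_le i (i - h n)
    rwa [sub_sub_cancel] at this
  linarith

/-- Undoing the conjugation moves the fixed box to `box (h n) R`, which eventually avoids any given
`box 0 m`; there `K` is small. -/
theorem _root_.IsPCompact.tendsto_conj_mul_cut {K : SeqSpace N p E →L[ℂ] SeqSpace N p E}
    (hK : IsPCompact (canonProj N p E) K) {h : ℕ → Fin N → ℤ} (hh : TendsToInfinity h) (R : ℝ) :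
    Tendsto (fun n => conj (h n) K * cut (box 0 R)) atTop (𝓝 0) := by
  rw [isPCompact_iff] at hK
  rw [NormedAddGroup.tendsto_nhds_zero]
  intro δ hδ
  obtain ⟨m, hm⟩ := (NormedAddGroup.tendsto_nhds_zero.1 hK.2 δ hδ).exists
  filter_upwards [hh.eventually_box_subset R m] with n hn
  rw [← conj_cut_box (h n), ← conj_mul, zero_add]
  refine (norm_conj_le _ _).trans_lt (lt_of_le_of_lt ?_ hm)
  have : cut (box (h n) R) = (1 - canonProj N p E m) * cut (box (h n) R) := by
    rw [canonProj_eq, one_sub_cut, cut_mul_cut, Set.inter_eq_right.2 hn]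
  rw [this, ← mul_assoc]
  exact (norm_mul_le _ _).trans (mul_le_of_le_one_right (norm_nonneg _) (norm_cut_le _))

theorem _root_.IsPCompact.tendsto_cut_mul_conj {K : SeqSpace N p E →L[ℂ] SeqSpace N p E}
    (hK : IsPCompact (canonProj N p E) K) {h : ℕ → Fin N → ℤ} (hh : TendsToInfinity h) (R : ℝ) :
    Tendsto (fun n => cut (box 0 R) * conj (h n) K) atTop (𝓝 0) := by
  rw [isPCompact_iff] at hK
  rw [NormedAddGroup.tendsto_nhds_zero]
  intro δ hδ
  obtain ⟨m, hm⟩ := (NormedAddGroup.tendsto_nhds_zero.1 hK.1 δ hδ).exists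
  filter_upwards [hh.eventually_box_subset R m] with n hn
  rw [← conj_cut_box (h n), ← conj_mul, zero_add]
  refine (norm_conj_le _ _).trans_lt (lt_of_le_of_lt ?_ hm)
  have : cut (box (h n) R) = cut (box (h n) R) * (1 - canonProj N p E m) := by
    rw [canonProj_eq, one_sub_cut, cut_mul_cut, Set.inter_eq_left.2 hn]
  rw [this, mul_assoc]
  exact (norm_mul_le _ _).trans (mul_le_of_le_one_left (norm_nonneg _) (norm_cut_le _))

theorem _root_.IsLimitOperator.tendsto_cut_mul {A B : SeqSpace N p E →L[ℂ] SeqSpace N p E}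
    {h : ℕ → Fin N → ℤ} (hB : IsLimitOperator A h B) (R : ℝ) :
    Tendsto (fun n => cut (box 0 R) * (conj (h n) A - B)) atTop (𝓝 0) :=
  squeeze_zero_norm (fun _ => le_add_of_nonneg_right (norm_nonneg _))
    (hB _ (isPCompact_cut (finite_box 0 R)))

theorem _root_.IsLimitOperator.tendsto_mul_cut {A B : SeqSpace N p E →L[ℂ] SeqSpace N p E}
    {h : ℕ → Fin N → ℤ} (hB : IsLimitOperator A h B) (R : ℝ) :
    Tendsto (fun n => (conj (h n) A - B) * cut (box 0 R)) atTop (𝓝 0) :=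
  squeeze_zero_norm (fun _ => le_add_of_nonneg_left (norm_nonneg _))
    (hB _ (isPCompact_cut (finite_box 0 R)))

theorem _root_.IsLimitOperator.sub_smul_one {A B : SeqSpace N p E →L[ℂ] SeqSpace N p E}
    {h : ℕ → Fin N → ℤ} (hB : IsLimitOperator A h B) (z : ℂ) :
    IsLimitOperator (A - z • 1) h (B - z • 1) := by
  intro K hK
  refine (hB K hK).congr fun n => ?_
  have : conj (h n) (A - z • 1) - (B - z • 1) = conj (h n) A - B := by
    rw [conj_sub, conj_smul, conj_one, sub_sub_sub_cancel_right]
  change _ = ‖K * (conj (h n) (A - z • 1) - (B - z • 1))‖ +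
    ‖(conj (h n) (A - z • 1) - (B - z • 1)) * K‖
  rw [this]
  rfl

theorem _root_.IsRich.sub_smul_one {A : SeqSpace N p E →L[ℂ] SeqSpace N p E} (hA : IsRich A)
    (z : ℂ) : IsRich (A - z • 1) := by
  intro h hh
  obtain ⟨φ, hφ, B, hB⟩ := hA h hh
  exact ⟨φ, hφ, _, hB.sub_smul_one z⟩

/-! ### Completeness of bounded operators with respect to `P`-convergence -/

/-- The Fatou property of the norm. It loses no constant, which keeps the norm bound on the limit
operator's inverse sharp. -/
theorem norm_le_of_tendsto_entry {x : ℕ → SeqSpace N p E} {y : SeqSpace N p E} {c : ℝ}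
    (hx : ∀ n, ‖x n‖ ≤ c) (h : ∀ i, Tendsto (fun n => entry (x n) i) atTop (𝓝 (entry y i))) :
    ‖y‖ ≤ c :=
  lp.norm_le_of_tendsto (l := atTop) (F := fun n => ((x n).1 : AmbientSeq N p E))
    (Eventually.of_forall hx) (tendsto_pi_nhds.2 h)

theorem exists_norm_sub_cut_le (hp : p = 0) (y : SeqSpace N p E) {δ : ℝ} (hδ : 0 < δ) :
    ∃ m : ℕ, ‖y - cut (box 0 m) y‖ ≤ δ := by
  have hy : y.1 ∈ (finSuppSeq N p E).topologicalClosure := by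
    obtain ⟨v, hv⟩ := y
    rwa [seqSubmodule, if_pos hp] at hv
  obtain ⟨v, hv, hyv⟩ := Metric.mem_closure_iff.1 hy δ hδ
  obtain ⟨C, hC⟩ := (Set.Finite.image (fun i => ‖i‖) hv).bddAbove
  obtain ⟨m, hm⟩ := exists_nat_ge C
  have hvm : ∀ i ∉ (box 0 m : Set (Fin N → ℤ)), v i = 0 := by
    intro i hi
    by_contra hne
    refine hi ?_
    rw [mem_box, sub_zero]
    exact (hC ⟨i, hne, rfl⟩).trans hm
  refine ⟨m, le_trans ?_ hyv.le⟩
  rw [dist_eq_norm]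
  refine lp.norm_mono (normExp_ne_zero p) fun i => ?_
  change ‖entry (y - cut (box 0 m) y) i‖ ≤ ‖entry y i - v i‖
  by_cases hi : i ∈ (box 0 m : Set (Fin N → ℤ))
  · rw [entry_sub, entry_cut_of_mem hi, sub_self, norm_zero]
    exact norm_nonneg _
  · rw [entry_sub, entry_cut_of_notMem hi, hvm i hi]

theorem mem_box_zero_natCeil (i : Fin N → ℤ) : i ∈ (box 0 (⌈‖i‖⌉₊ : ℕ) : Set (Fin N → ℤ)) := by
  rw [mem_box, sub_zero]
  exact Nat.le_ceil _

theorem norm_entry_le_norm_cut {S : Set (Fin N → ℤ)} {i : Fin N → ℤ} (hi : i ∈ S)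
    (x : SeqSpace N p E) : ‖entry x i‖ ≤ ‖cut S x‖ := by
  rw [← entry_cut_of_mem hi x]
  exact norm_entry_le _ i

theorem eq_zero_of_cut_mul {T : SeqSpace N p E →L[ℂ] SeqSpace N p E}
    (h : ∀ m : ℕ, cut (box 0 m) * T = 0) : T = 0 := by
  ext x : 1
  refine ext fun i => ?_
  have h1 : cut (box 0 (⌈‖i‖⌉₊ : ℕ)) (T x) = 0 := by
    change (cut (box 0 (⌈‖i‖⌉₊ : ℕ)) * T : SeqSpace N p E →L[ℂ] SeqSpace N p E) x = 0
    rw [h]; rfl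
  rw [← entry_cut_of_mem (mem_box_zero_natCeil i), h1]
  rfl

/-- Entrywise limits suffice for `p ≥ 1`, where the left Cauchy condition provides them and the
Fatou property puts the limit in the space. For `p = 0` an entrywise limit could leave the space, so
norm convergence is needed, and the right Cauchy condition supplies it. -/
theorem exists_entry_limit [CompleteSpace E] {T : ℕ → SeqSpace N p E →L[ℂ] SeqSpace N p E}
    {t : ℝ} (ht : ∀ n, ‖T n‖ ≤ t)
    (hl : ∀ m : ℕ, ∀ δ > 0, ∃ n₀, ∀ n ≥ n₀, ∀ k ≥ n₀, ‖cut (box 0 m) * (T n - T k)‖ ≤ δ)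
    (hr : ∀ m : ℕ, ∀ δ > 0, ∃ n₀, ∀ n ≥ n₀, ∀ k ≥ n₀, ‖(T n - T k) * cut (box 0 m)‖ ≤ δ)
    (y : SeqSpace N p E) :
    ∃ x : SeqSpace N p E, ∀ i, Tendsto (fun n => entry (T n y) i) atTop (𝓝 (entry x i)) := by
  have ht0 : 0 ≤ t := (norm_nonneg _).trans (ht 0)
  rcases (Fact.out : p = 0 ∨ 1 ≤ p) with hp | hp
  · have hc : CauchySeq fun n => T n y := by
      rw [Metric.cauchySeq_iff']
      intro δ hδ
      -- Split `y` into its part in a box, controlled by the right Cauchy condition, and a tail that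
      -- is small because `y` is a limit of finitely supported sequences.
      obtain ⟨m, hm⟩ := exists_norm_sub_cut_le hp y (show 0 < δ / (8 * (t + 1)) by positivity)
      obtain ⟨n₀, hn₀⟩ := hr m (δ / (8 * (‖y‖ + 1))) (by positivity)
      refine ⟨n₀, fun n hn => ?_⟩
      rw [dist_eq_norm]
      have h1 : T n y - T n₀ y =
          ((T n - T n₀) * cut (box 0 m) : SeqSpace N p E →L[ℂ] SeqSpace N p E) y +
          (T n - T n₀) (y - cut (box 0 m) y) := by
        change T n y - T n₀ y = (T n - T n₀) (cut (box 0 m) y) + (T n - T n₀) (y - cut (box 0 m) y)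
        rw [← map_add, add_sub_cancel]; rfl
      have h2 : ‖((T n - T n₀) * cut (box 0 m) : SeqSpace N p E →L[ℂ] SeqSpace N p E) y‖ ≤
          δ / (8 * (‖y‖ + 1)) * (‖y‖ + 1) :=
        (ContinuousLinearMap.le_of_opNorm_le _ (hn₀ n hn n₀ le_rfl) y).trans
          (by gcongr; linarith)
      have h3 : ‖(T n - T n₀) (y - cut (box 0 m) y)‖ ≤ (2 * (t + 1)) * (δ / (8 * (t + 1))) := by
        refine (ContinuousLinearMap.le_opNorm _ _).trans ?_
        gcongr
        refine (norm_sub_le _ _).trans ?_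
        linarith [ht n, ht n₀]
      have h4 : δ / (8 * (‖y‖ + 1)) * (‖y‖ + 1) = δ / 8 := by field_simp
      have h5 : (2 * (t + 1)) * (δ / (8 * (t + 1))) = δ / 4 := by field_simp; norm_num
      rw [h1]
      refine (norm_add_le _ _).trans_lt ?_
      linarith
    obtain ⟨x, hx⟩ := cauchySeq_tendsto_of_complete hc
    exact ⟨x, fun i => ((continuous_entry i).tendsto x).comp hx⟩
  · have hf : ∀ i, ∃ e : E, Tendsto (fun n => entry (T n y) i) atTop (𝓝 e) := by
      intro i
      refine cauchySeq_tendsto_of_complete ?_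
      rw [Metric.cauchySeq_iff']
      intro δ hδ
      obtain ⟨n₀, hn₀⟩ := hl ⌈‖i‖⌉₊ (δ / (2 * (‖y‖ + 1))) (by positivity)
      refine ⟨n₀, fun n hn => ?_⟩
      rw [dist_eq_norm, ← entry_sub]
      refine (norm_entry_le_norm_cut (mem_box_zero_natCeil i) _).trans_lt ?_
      have h1 := ContinuousLinearMap.le_of_opNorm_le _ (hn₀ n hn n₀ le_rfl) y
      refine lt_of_le_of_lt h1 ?_
      have h4 : δ / (2 * (‖y‖ + 1)) * (‖y‖ + 1) = δ / 2 := by field_simp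
      have h5 : δ / (2 * (‖y‖ + 1)) * ‖y‖ ≤ δ / (2 * (‖y‖ + 1)) * (‖y‖ + 1) := by
        gcongr; linarith
      linarith
    choose f hf using hf
    have hmem : Memℓp f (normExp p) := by
      refine lp.memℓp_of_tendsto (l := atTop)
        (F := fun n => ((T n y).1 : AmbientSeq N p E)) ?_ (tendsto_pi_nhds.2 hf)
      refine isBounded_iff_forall_norm_le.2 ⟨t * ‖y‖, ?_⟩
      rintro _ ⟨n, rfl⟩
      exact (T n).le_of_opNorm_le (ht n) y
    refine ⟨⟨⟨f, hmem⟩, ?_⟩, hf⟩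
    unfold seqSubmodule
    rw [if_neg (zero_lt_one.trans_le hp).ne']
    trivial

theorem exists_pLimit [CompleteSpace E] {T : ℕ → SeqSpace N p E →L[ℂ] SeqSpace N p E}
    {t : ℝ} (ht : ∀ n, ‖T n‖ ≤ t)
    (hl : ∀ m : ℕ, ∀ δ > 0, ∃ n₀, ∀ n ≥ n₀, ∀ k ≥ n₀, ‖cut (box 0 m) * (T n - T k)‖ ≤ δ)
    (hr : ∀ m : ℕ, ∀ δ > 0, ∃ n₀, ∀ n ≥ n₀, ∀ k ≥ n₀, ‖(T n - T k) * cut (box 0 m)‖ ≤ δ) :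
    ∃ C : SeqSpace N p E →L[ℂ] SeqSpace N p E, ‖C‖ ≤ t ∧
      ∀ m : ℕ, ∀ δ > 0, ∃ n₀, ∀ n ≥ n₀, ‖cut (box 0 m) * (T n - C)‖ ≤ δ := by
  have ht0 : 0 ≤ t := (norm_nonneg _).trans (ht 0)
  choose c hc using exists_entry_limit ht hl hr
  have hbound : ∀ y, ‖c y‖ ≤ t * ‖y‖ := fun y =>
    norm_le_of_tendsto_entry (fun n => (T n).le_of_opNorm_le (ht n) y) (hc y)
  have hadd : ∀ x y, c (x + y) = c x + c y := fun x y =>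
    ext fun i => tendsto_nhds_unique (hc (x + y) i) (by
      simp only [map_add, entry_add]
      exact (hc x i).add (hc y i))
  have hsmul : ∀ (a : ℂ) x, c (a • x) = a • c x := fun a x =>
    ext fun i => tendsto_nhds_unique (hc (a • x) i) (by
      simp only [map_smul, entry_smul]
      exact (hc x i).const_smul a)
  obtain ⟨C, hCt, hCc⟩ : ∃ C : SeqSpace N p E →L[ℂ] SeqSpace N p E, ‖C‖ ≤ t ∧ ∀ y, C y = c y :=
    ⟨LinearMap.mkContinuous { toFun := c, map_add' := hadd, map_smul' := hsmul } t hbound,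
      LinearMap.mkContinuous_norm_le _ ht0 hbound, fun _ => rfl⟩
  refine ⟨C, hCt, fun m δ hδ => ?_⟩
  obtain ⟨n₀, hn₀⟩ := hl m δ hδ
  refine ⟨n₀, fun n hn => ContinuousLinearMap.opNorm_le_bound _ hδ.le fun y => ?_⟩
  refine norm_le_of_tendsto_entry (x := fun k => (cut (box 0 m) * (T n - T (k + n₀)) :
    SeqSpace N p E →L[ℂ] SeqSpace N p E) y)
    (fun k => ContinuousLinearMap.le_of_opNorm_le _ (hn₀ n hn _ (Nat.le_add_left _ _)) y)
    fun i => ?_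
  change Tendsto (fun k => entry (cut (box 0 m) (T n y - T (k + n₀) y)) i) atTop
    (𝓝 (entry (cut (box 0 m) (T n y - C y)) i))
  rw [hCc]
  by_cases hi : i ∈ (box 0 m : Set (Fin N → ℤ))
  · simp only [entry_cut_of_mem hi, entry_sub]
    exact tendsto_const_nhds.sub ((tendsto_add_atTop_iff_nat n₀).2 (hc y i))
  · simp only [entry_cut_of_notMem hi]
    exact tendsto_const_nhds

/-! ### Limit operators of operators that are invertible modulo `P`-compact ones -/

theorem norm_mul_mul_le {R : Type*} [NormedRing R] {a b c : R} {s t : ℝ} (ha : ‖a‖ ≤ s)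
    (hc : ‖c‖ ≤ t) : ‖a * b * c‖ ≤ s * t * ‖b‖ := by
  have hs := (norm_nonneg a).trans ha
  calc ‖a * b * c‖ ≤ ‖a‖ * ‖b‖ * ‖c‖ :=
        (norm_mul_le _ _).trans (by gcongr; exact norm_mul_le _ _)
    _ ≤ s * ‖b‖ * t := by gcongr
    _ = _ := by ring

/-- Here `b` and `b'` are approximate inverses of `a` and `a'` near `φ`. Passing from `b φ` to `φ
b'` costs only the inversion errors, the difference of `a` and `a'`, and the commutator of `a` with
`φ`; no commutation property of `b` is presupposed. -/
theorem norm_mul_sub_mul_le {R : Type*} [NormedRing R] {a a' b b' φ : R} {t : ℝ}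
    (hb : ‖b‖ ≤ t) (hb' : ‖b'‖ ≤ t) :
    ‖b * φ - φ * b'‖ ≤ t * t * ‖φ * (a' - a)‖ + t * t * ‖a * φ - φ * a‖ +
      t * ‖(b * a - 1) * φ‖ + t * ‖φ * (a' * b' - 1)‖ := by
  have h : b * φ - φ * b' = b * (φ * (a' - a)) * b' - b * (a * φ - φ * a) * b' +
      (b * a - 1) * φ * b' - b * (φ * (a' * b' - 1)) := by noncomm_ring
  have h1 : ‖(b * a - 1) * φ * b'‖ ≤ t * ‖(b * a - 1) * φ‖ := by
    refine (norm_mul_le _ _).trans ?_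
    rw [mul_comm]; gcongr
  have h2 : ‖b * (φ * (a' * b' - 1))‖ ≤ t * ‖φ * (a' * b' - 1)‖ :=
    (norm_mul_le _ _).trans (by gcongr)
  rw [h]
  refine (norm_sub_le _ _).trans (add_le_add ((norm_add_le _ _).trans
    (add_le_add ((norm_sub_le _ _).trans (add_le_add ?_ ?_)) h1)) h2)
  · exact norm_mul_mul_le hb hb'
  · exact norm_mul_mul_le hb hb'

/-- If `φ` almost commutes with `D`, then an approximate right inverse near `φ` gives an estimate
for the error of a right inverse. -/
theorem norm_mul_mul_sub_one_le {R : Type*} [NormedRing R] {a b C D φ : R} {t : ℝ}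
    (hb : ‖b‖ ≤ t) (hC : ‖C‖ ≤ t) :
    ‖φ * (D * C - 1)‖ ≤ (‖a * φ - φ * a‖ + ‖φ * (a - D)‖ + ‖(a - D) * φ‖) * (t + t) +
      ‖D‖ * ‖φ * (b - C)‖ + ‖φ * (a - D)‖ * t + ‖φ * (a * b - 1)‖ := by
  have h : φ * (D * C - 1) = -((a * φ - φ * a) + φ * (a - D) - (a - D) * φ) * (C - b) -
      D * (φ * (b - C)) - φ * (a - D) * b + φ * (a * b - 1) := by noncomm_ring
  rw [h]
  refine (norm_add_le _ _).trans (add_le_add_left ((norm_sub_le _ _).trans (add_le_add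
    ((norm_sub_le _ _).trans (add_le_add ((norm_mul_le _ _).trans ?_) (norm_mul_le _ _)))
    ((norm_mul_le _ _).trans (by gcongr)))) _)
  rw [norm_neg]
  gcongr
  · exact (norm_sub_le _ _).trans (add_le_add_left (norm_add_le _ _) _)
  · exact (norm_sub_le _ _).trans (add_le_add hC hb)

/-- The counterpart for a left inverse. It uses the commutator of `b` with `φ`, so that `b - C`
again appears only with `φ` on its left. -/
theorem norm_mul_mul_sub_one_le' {R : Type*} [NormedRing R] {a b C D φ : R} {t : ℝ}
    (hb : ‖b‖ ≤ t) :
    ‖φ * (C * D - 1)‖ ≤ ‖φ * (b - C)‖ * ‖D‖ + ‖b * φ - φ * b‖ * ‖D‖ + t * ‖φ * (a - D)‖ +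
      t * ‖a * φ - φ * a‖ + ‖(b * a - 1) * φ‖ := by
  have h : φ * (C * D - 1) = -(φ * (b - C) * D) - (b * φ - φ * b) * D - b * (φ * (a - D)) -
      b * (a * φ - φ * a) + (b * a - 1) * φ := by noncomm_ring
  rw [h]
  refine (norm_add_le _ _).trans (add_le_add_left ((norm_sub_le _ _).trans (add_le_add
    ((norm_sub_le _ _).trans (add_le_add ((norm_sub_le _ _).trans (add_le_add ?_ ?_)) ?_)) ?_)) _)
  · rw [norm_neg]; exact norm_mul_le _ _
  · exact norm_mul_le _ _
  · exact (norm_mul_le _ _).trans (by gcongr)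
  · exact (norm_mul_le _ _).trans (by gcongr)

theorem norm_conj_commutator_le (A : SeqSpace N p E →L[ℂ] SeqSpace N p E) (α : Fin N → ℤ)
    {r δ : ℝ} (h : ∀ k, ‖A * trapOp p E r k - trapOp p E r k * A‖ ≤ δ) :
    ‖conj α A * trapOp p E r 0 - trapOp p E r 0 * conj α A‖ ≤ δ := by
  rw [← conj_trapOp α, ← conj_mul, ← conj_mul, ← conj_sub]
  exact (norm_conj_le _ _).trans (h _)

theorem norm_cut_mul_le_norm_trapOp_mul {r : ℝ} (hr : 0 < r) {S : Set (Fin N → ℤ)}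
    (hS : S ⊆ box 0 r) (T : SeqSpace N p E →L[ℂ] SeqSpace N p E) :
    ‖cut S * T‖ ≤ ‖trapOp p E r 0 * T‖ := by
  rw [← cut_mul_trapOp_eq_cut hr hS, mul_assoc]
  exact (norm_mul_le _ _).trans (mul_le_of_le_one_left (norm_nonneg _) (norm_cut_le _))

theorem norm_mul_cut_le_norm_mul_trapOp {r : ℝ} (hr : 0 < r) {S : Set (Fin N → ℤ)}
    (hS : S ⊆ box 0 r) (T : SeqSpace N p E →L[ℂ] SeqSpace N p E) :
    ‖T * cut S‖ ≤ ‖T * trapOp p E r 0‖ := by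
  rw [← trapOp_mul_cut hr hS, ← mul_assoc]
  exact (norm_mul_le _ _).trans (mul_le_of_le_one_right (norm_nonneg _) (norm_cut_le _))

theorem tendsto_trapOp_mul {r : ℝ} (hr : 0 < r) {R : ℝ} (hR : 2 * r ≤ R)
    {T : ℕ → SeqSpace N p E →L[ℂ] SeqSpace N p E}
    (h : Tendsto (fun n => cut (box 0 R) * T n) atTop (𝓝 0)) :
    Tendsto (fun n => ‖trapOp p E r 0 * T n‖) atTop (𝓝 0) := by
  refine squeeze_zero (fun _ => norm_nonneg _) (fun n => ?_) (tendsto_norm_zero.comp h)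
  rw [← trapOp_mul_cut_of_subset hr (S := box 0 R) fun i hi => (mem_box.1 hi).trans hR, mul_assoc]
  exact (norm_mul_le _ _).trans (mul_le_of_le_one_left (norm_nonneg _) (norm_trapOp_le _ _))

theorem tendsto_mul_trapOp {r : ℝ} (hr : 0 < r) {R : ℝ} (hR : 2 * r ≤ R)
    {T : ℕ → SeqSpace N p E →L[ℂ] SeqSpace N p E}
    (h : Tendsto (fun n => T n * cut (box 0 R)) atTop (𝓝 0)) :
    Tendsto (fun n => ‖T n * trapOp p E r 0‖) atTop (𝓝 0) := by
  refine squeeze_zero (fun _ => norm_nonneg _) (fun n => ?_) (tendsto_norm_zero.comp h)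
  rw [← cut_mul_trapOp_of_subset hr (S := box 0 R) fun i hi => (mem_box.1 hi).trans hR,
    ← mul_assoc]
  exact (norm_mul_le _ _).trans (mul_le_of_le_one_right (norm_nonneg _) (norm_trapOp_le _ _))

/-- The inverse is the limit, on boxes from the left, of the conjugates of the regularizer `B`; its
norm is at most `t` since conjugation does not increase norms. -/
theorem _root_.IsLimitOperator.exists_inverse [CompleteSpace E]
    {A B D : SeqSpace N p E →L[ℂ] SeqSpace N p E}
    (hA : IsBandDominated A) {t : ℝ} (hB : ‖B‖ ≤ t)
    (hAB : IsPCompact (canonProj N p E) (A * B - 1))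
    (hBA : IsPCompact (canonProj N p E) (B * A - 1)) {h : ℕ → Fin N → ℤ}
    (hh : TendsToInfinity h) (hD : IsLimitOperator A h D) :
    ∃ C, D * C = 1 ∧ C * D = 1 ∧ ‖C‖ ≤ t := by
  have ht0 : 0 ≤ t := (norm_nonneg _).trans hB
  set a := fun n => conj (h n) A with ha
  set b := fun n => conj (h n) B with hb
  have hbt : ∀ n, ‖b n‖ ≤ t := fun n => (norm_conj_le _ _).trans hB
  have hab : ∀ n, conj (h n) (A * B - 1) = a n * b n - 1 := fun n => by
    rw [conj_sub, conj_mul, conj_one]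
  have hba : ∀ n, conj (h n) (B * A - 1) = b n * a n - 1 := fun n => by
    rw [conj_sub, conj_mul, conj_one]
  have hlim : ∀ r : ℝ, 0 < r →
      Tendsto (fun n => ‖trapOp p E r 0 * (a n - D)‖) atTop (𝓝 0) ∧
      Tendsto (fun n => ‖(a n - D) * trapOp p E r 0‖) atTop (𝓝 0) ∧
      Tendsto (fun n => ‖trapOp p E r 0 * (a n * b n - 1)‖) atTop (𝓝 0) ∧
      Tendsto (fun n => ‖(b n * a n - 1) * trapOp p E r 0‖) atTop (𝓝 0) := fun r hr => by
    refine ⟨tendsto_trapOp_mul hr le_rfl (hD.tendsto_cut_mul _),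
      tendsto_mul_trapOp hr le_rfl (hD.tendsto_mul_cut _),
      tendsto_trapOp_mul hr le_rfl ?_, tendsto_mul_trapOp hr le_rfl ?_⟩
    · simpa only [hab] using hAB.tendsto_cut_mul_conj hh (2 * r)
    · simpa only [hba] using hBA.tendsto_conj_mul_cut hh (2 * r)
  -- The width `r` is chosen first to make the commutator small; with `r` fixed, all other errors
  -- tend to zero.
  have hcauchy : ∀ (m : ℕ), ∀ δ > 0, ∃ r : ℝ, 0 < r ∧ (m : ℝ) ≤ r ∧ ∃ n₀, ∀ n ≥ n₀, ∀ k ≥ n₀,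
      ‖b n * trapOp p E r 0 - trapOp p E r 0 * b k‖ ≤ δ := by
    intro m δ hδ
    obtain ⟨r₀, hr₀, hcomm⟩ := hA.exists_commutator_le (δ := δ / (4 * (t + 1) ^ 2))
      (by positivity)
    have hr : 0 < max r₀ m := lt_max_of_lt_left hr₀
    refine ⟨max r₀ m, hr, le_max_right _ _, ?_⟩
    set φ := trapOp p E (max r₀ m) (0 : Fin N → ℤ)
    obtain ⟨l1, -, l3, l4⟩ := hlim _ hr
    have e1 := l1.eventually_le_const (show 0 < δ / (8 * (t + 1) ^ 2) by positivity)
    have e3 := l3.eventually_le_const (show 0 < δ / (4 * (t + 1)) by positivity)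
    have e4 := l4.eventually_le_const (show 0 < δ / (4 * (t + 1)) by positivity)
    obtain ⟨n₀, hn₀⟩ := eventually_atTop.1 (e1.and (e3.and e4))
    refine ⟨n₀, fun n hn k hk => ?_⟩
    have hsq : t * t ≤ (t + 1) ^ 2 := by nlinarith
    have h1 : ‖φ * (a k - a n)‖ ≤ δ / (4 * (t + 1) ^ 2) := by
      have : φ * (a k - a n) = φ * (a k - D) - φ * (a n - D) := by noncomm_ring
      rw [this]
      refine (norm_sub_le _ _).trans ((add_le_add (hn₀ k hk).1 (hn₀ n hn).1).trans_eq ?_)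
      field_simp; norm_num
    have h2 := norm_conj_commutator_le A (h n) (hcomm _ (le_max_left r₀ (m : ℝ)))
    refine (norm_mul_sub_mul_le (a := a n) (a' := a k) (hbt n) (hbt k)).trans ?_
    calc _ ≤ (t + 1) ^ 2 * (δ / (4 * (t + 1) ^ 2)) + (t + 1) ^ 2 * (δ / (4 * (t + 1) ^ 2)) +
          (t + 1) * (δ / (4 * (t + 1))) + (t + 1) * (δ / (4 * (t + 1))) := by
          gcongr
          · linarith
          · exact (hn₀ n hn).2.2
          · linarith
          · exact (hn₀ k hk).2.1
      _ = δ := by field_simp; norm_num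
  have hsub : ∀ {m : ℕ} {r : ℝ}, (m : ℝ) ≤ r → (box 0 m : Set (Fin N → ℤ)) ⊆ box 0 r :=
    fun hmr i hi => (mem_box.1 hi).trans hmr
  obtain ⟨C, hC, hbC⟩ := exists_pLimit hbt
    (fun m δ hδ => by
      obtain ⟨r, hr, hmr, n₀, hn₀⟩ := hcauchy m (δ / 2) (by positivity)
      refine ⟨n₀, fun n hn k hk => (norm_cut_mul_le_norm_trapOp_mul hr (hsub hmr) _).trans ?_⟩
      -- Subtracting the case `k = n` removes the commutator of `b n` with the cut-off.
      have : trapOp p E r 0 * (b n - b k) = (b n * trapOp p E r 0 - trapOp p E r 0 * b k) -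
        (b n * trapOp p E r 0 - trapOp p E r 0 * b n) := by noncomm_ring
      rw [this]
      refine (norm_sub_le _ _).trans ?_
      linarith [hn₀ n hn k hk, hn₀ n hn n hn])
    (fun m δ hδ => by
      obtain ⟨r, hr, hmr, n₀, hn₀⟩ := hcauchy m (δ / 2) (by positivity)
      refine ⟨n₀, fun n hn k hk => (norm_mul_cut_le_norm_mul_trapOp hr (hsub hmr) _).trans ?_⟩
      have : (b n - b k) * trapOp p E r 0 = (b n * trapOp p E r 0 - trapOp p E r 0 * b k) -
        (b k * trapOp p E r 0 - trapOp p E r 0 * b k) := by noncomm_ring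
      rw [this]
      refine (norm_sub_le _ _).trans ?_
      linarith [hn₀ n hn k hk, hn₀ k hk k hk])
  have hφC : ∀ r : ℝ, 0 < r → Tendsto (fun n => ‖trapOp p E r 0 * (b n - C)‖) atTop (𝓝 0) := by
    intro r hr
    obtain ⟨m, hm⟩ := exists_nat_ge (2 * r)
    refine tendsto_trapOp_mul hr hm ?_
    rw [NormedAddGroup.tendsto_nhds_zero]
    intro δ hδ
    obtain ⟨n₀, hn₀⟩ := hbC m (δ / 2) (by positivity)
    exact eventually_atTop.2 ⟨n₀, fun n hn => (hn₀ n hn).trans_lt (by linarith)⟩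
  -- For a fixed cut-off, letting `n → ∞` kills every error except the commutator, which is at most
  -- `δ`; then `δ` is arbitrary.
  have hfinal : ∀ (m : ℕ), ∀ δ > 0, ‖cut (box 0 m) * (D * C - 1)‖ ≤ 2 * t * δ ∧
      ‖cut (box 0 m) * (C * D - 1)‖ ≤ (t * t * ‖D‖ + t) * δ := by
    intro m δ hδ
    obtain ⟨r₀, hr₀, hcomm⟩ := hA.exists_commutator_le hδ
    have hr : 0 < max r₀ m := lt_max_of_lt_left hr₀
    have hmr := le_max_right r₀ (m : ℝ)
    have hc := fun n => norm_conj_commutator_le A (h n) (hcomm _ (le_max_left r₀ (m : ℝ)))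
    refine ⟨(norm_cut_mul_le_norm_trapOp_mul hr (hsub hmr) _).trans ?_,
      (norm_cut_mul_le_norm_trapOp_mul hr (hsub hmr) _).trans ?_⟩
    all_goals
      set φ := trapOp p E (max r₀ m) (0 : Fin N → ℤ)
      obtain ⟨l1, l2, l3, l4⟩ := hlim _ hr
      have l5 := hφC _ hr
    · have hl : Tendsto (fun n => (δ + ‖φ * (a n - D)‖ + ‖(a n - D) * φ‖) * (t + t) +
          ‖D‖ * ‖φ * (b n - C)‖ + ‖φ * (a n - D)‖ * t + ‖φ * (a n * b n - 1)‖) atTop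
          (𝓝 ((δ + 0 + 0) * (t + t) + ‖D‖ * 0 + 0 * t + 0)) :=
        (((((l1.const_add δ).add l2).mul_const _).add (l5.const_mul _)).add
          (l1.mul_const _)).add l3
      refine (ge_of_tendsto' hl fun n => ?_).trans_eq (by ring)
      refine (norm_mul_mul_sub_one_le (a := a n) (hbt n) hC).trans ?_
      gcongr
      exact hc n
    · have hl : Tendsto (fun n => ‖φ * (b n - C)‖ * ‖D‖ + (t * t * 0 + t * t * δ +
          t * ‖(b n * a n - 1) * φ‖ + t * ‖φ * (a n * b n - 1)‖) * ‖D‖ + t * ‖φ * (a n - D)‖ +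
          t * δ + ‖(b n * a n - 1) * φ‖) atTop
          (𝓝 (0 * ‖D‖ + (t * t * 0 + t * t * δ + t * 0 + t * 0) * ‖D‖ + t * 0 + t * δ + 0)) :=
        ((((l5.mul_const _).add ((((l4.const_mul t).const_add _).add
          (l3.const_mul t)).mul_const _)).add (l1.const_mul t)).add_const _).add l4
      refine (ge_of_tendsto' hl fun n => ?_).trans_eq (by ring)
      refine (norm_mul_mul_sub_one_le' (a := a n) (hbt n)).trans ?_
      -- With `a' = a` this bounds the commutator of `b n` with `φ`.
      have h1 := norm_mul_sub_mul_le (a := a n) (a' := a n) (φ := φ) (hbt n) (hbt n)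
      rw [sub_self, mul_zero, norm_zero] at h1
      have h2 := hc n
      gcongr
      refine h1.trans ?_
      gcongr
  have hzero : ∀ T : SeqSpace N p E →L[ℂ] SeqSpace N p E, ∀ c : ℝ,
      (∀ m : ℕ, ∀ δ > 0, ‖cut (box 0 m) * T‖ ≤ c * δ) → T = 0 := by
    intro T c hT
    refine eq_zero_of_cut_mul fun m => ?_
    rw [← norm_le_zero_iff]
    have hl : Tendsto (fun n : ℕ => c * (1 / ((n : ℝ) + 1))) atTop (𝓝 (c * 0)) :=
      tendsto_one_div_add_atTop_nhds_zero_nat.const_mul c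
    refine (ge_of_tendsto' hl fun n => hT m _ (by positivity)).trans_eq (mul_zero c)
  exact ⟨C, sub_eq_zero.1 (hzero _ _ fun m δ hδ => (hfinal m δ hδ).1),
    sub_eq_zero.1 (hzero _ _ fun m δ hδ => (hfinal m δ hδ).2), hC⟩

/-! ### Local inverses -/

/-- If it failed, the bad centres would tend to infinity, and richness would give a limit operator
along a subsequence of them. The inverse of that limit operator, translated back to a late centre,
is a local inverse there. -/
theorem exists_local_inverse {A : SeqSpace N p E →L[ℂ] SeqSpace N p E} (hA : IsRich A) {c : ℝ}
    (hc : ∀ D ∈ opSpectrum A, ∃ C, D * C = 1 ∧ C * D = 1 ∧ ‖C‖ ≤ c) (R : ℝ) {δ : ℝ}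
    (hδ : 0 < δ) :
    ∃ ρ : ℝ, ∀ k, ρ < ‖k‖ → ∃ B, ‖B‖ ≤ c ∧ ‖cut (box k R) * (A * B - 1)‖ ≤ δ ∧
      ‖(B * A - 1) * cut (box k R)‖ ≤ δ := by
  by_contra! hcon
  choose h hh hno using fun n : ℕ => hcon n
  have hinf : TendsToInfinity h :=
    tendsto_atTop_mono (fun n => (hh n).le) tendsto_natCast_atTop_atTop
  obtain ⟨φ, hφ, D, hD⟩ := hA h hinf
  obtain ⟨C, hDC, hCD, hC⟩ := hc D ⟨h ∘ φ, hinf.comp hφ.tendsto_atTop, hD⟩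
  have h1 : Tendsto (fun n => cut (box 0 R) * (conj (h (φ n)) A - D) * C) atTop (𝓝 0) := by
    simpa using (hD.tendsto_cut_mul R).mul_const C
  have h2 : Tendsto (fun n => C * ((conj (h (φ n)) A - D) * cut (box 0 R))) atTop (𝓝 0) := by
    simpa using (hD.tendsto_mul_cut R).const_mul C
  rw [NormedAddGroup.tendsto_nhds_zero] at h1 h2
  obtain ⟨n, hn1, hn2⟩ := ((h1 δ hδ).and (h2 δ hδ)).exists
  set k := h (φ n) with hk
  have hcut : cut (box k R) =
      conj (-k) (cut (box 0 R) : SeqSpace N p E →L[ℂ] SeqSpace N p E) := by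
    rw [← conj_cut_box k 0 R, conj_neg_conj, zero_add]
  have hA' : A = conj (-k) (conj k A) := (conj_neg_conj k A).symm
  refine (hno (φ n) (conj (-k) C) ((norm_conj_le _ _).trans hC) ?_).not_ge ?_
  · have : cut (box k R) * (A * conj (-k) C - 1) =
        conj (-k) (cut (box 0 R) * (conj k A - D) * C) := by
      rw [mul_assoc, sub_mul, hDC, conj_mul, conj_sub, conj_mul, conj_one, ← hA', hcut]
    rw [this]
    exact (norm_conj_le _ _).trans hn1.le
  · have : (conj (-k) C * A - 1) * cut (box k R) =
        conj (-k) (C * ((conj k A - D) * cut (box 0 R))) := by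
      rw [← mul_assoc, mul_sub, hCD, conj_mul, conj_sub, conj_mul, conj_one, ← hA', hcut]
    rw [this]
    exact (norm_conj_le _ _).trans hn2.le

/-! ### Localization of norms -/

theorem summable_trap_rpow {r : ℝ} (hr : 0 < r) {s : ℝ} (hs : 0 < s) :
    Summable fun j : Fin N → ℤ => trap r j ^ s := by
  refine summable_of_hasFiniteSupport ((finite_box 0 (2 * r)).subset fun j hj => ?_)
  by_contra hcon
  refine hj ?_
  rw [mem_box, sub_zero, not_le] at hcon
  change trap r j ^ s = 0
  rw [trap_eq_zero hr hcon.le, Real.zero_rpow hs.ne']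

theorem tsum_trap_rpow_pos {r : ℝ} (hr : 0 < r) {s : ℝ} (hs : 0 < s) :
    0 < ∑' j : Fin N → ℤ, trap r j ^ s :=
  (summable_trap_rpow hr hs).tsum_pos (fun j => Real.rpow_nonneg (trap_nonneg r j) s) 0 (by
    rw [trap_eq_one hr (by simpa using hr.le), Real.one_rpow]; exact one_pos)

/-- Tonelli's theorem for a convolution of two nonnegative summable functions on a group. -/
theorem hasSum_tsum_of_hasSum_conv {G : Type*} [AddGroup G] {w a b : G → ℝ} {W M : ℝ}
    (hw : HasSum w W) (ha : HasSum a M) (hw0 : ∀ j, 0 ≤ w j) (ha0 : ∀ i, 0 ≤ a i)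
    (hb : ∀ k, HasSum (fun i => w (i - k) * a i) (b k)) : HasSum b (W * M) := by
  have hprod : HasSum (fun z : G × G => w z.1 * a z.2) (W * M) :=
    hw.mul ha (hw.summable.mul_of_nonneg ha.summable hw0 ha0)
  -- The substitution `(k, i) ↦ (i - k, i)` turns the product of the two series into the fibrewise
  -- sums `b k`.
  let e : G × G ≃ G × G :=
    { toFun := fun z => (z.2 - z.1, z.2)
      invFun := fun z => (-z.1 + z.2, z.2)
      left_inv := fun z => by simp
      right_inv := fun z => by simp }
  exact (e.hasSum_iff.2 hprod).prod_fiberwise hb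

theorem exists_norm_localization_lp_top {F : Type*} [NormedAddCommGroup F] {r : ℝ} (hr : 0 < r)
    (x : lp (fun _ : Fin N → ℤ => F) ∞) (y : (Fin N → ℤ) → lp (fun _ : Fin N → ℤ => F) ∞)
    (hy : ∀ k i, ‖y k i‖ = trap r (i - k) * ‖x i‖) :
    ∃ u : lp (fun _ : Fin N → ℤ => ℝ) ∞, (∀ k, u k = ‖y k‖) ∧ ‖u‖ = ‖x‖ := by
  have hle : ∀ k, ‖y k‖ ≤ ‖x‖ := fun k => lp.norm_mono ENNReal.top_ne_zero fun i => by
    rw [hy]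
    exact mul_le_of_le_one_left (norm_nonneg _) (trap_le_one _ _)
  have hnn : ∀ k, ‖(‖y k‖ : ℝ)‖ = ‖y k‖ := fun k => Real.norm_of_nonneg (norm_nonneg (y k))
  have hmem : Memℓp (E := fun _ : Fin N → ℤ => ℝ) (fun k => ‖y k‖) ∞ :=
    memℓp_infty ⟨‖x‖, by rintro _ ⟨k, rfl⟩; exact (hnn k).trans_le (hle k)⟩
  refine ⟨⟨_, hmem⟩, fun k => rfl, ?_⟩
  refine le_antisymm (lp.norm_le_of_forall_le (norm_nonneg _) fun k => (hnn k).trans_le (hle k))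
    (lp.norm_le_of_forall_le (norm_nonneg _) fun i => ?_)
  have h1 : ‖x i‖ = ‖y i i‖ := by
    rw [hy, sub_self, trap_eq_one hr (by simpa using hr.le), one_mul]
  rw [h1]
  refine (lp.norm_apply_le_norm ENNReal.top_ne_zero (y i) i).trans ?_
  exact (hnn i).symm.trans_le (lp.norm_apply_le_norm ENNReal.top_ne_zero
    (⟨_, hmem⟩ : lp (fun _ : Fin N → ℤ => ℝ) ∞) i)

theorem exists_norm_localization_lp_of_toReal_pos {F : Type*} [NormedAddCommGroup F]
    {q : ℝ≥0∞} (hs : 0 < q.toReal) {r : ℝ} (hr : 0 < r) (x : lp (fun _ : Fin N → ℤ => F) q)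
    (y : (Fin N → ℤ) → lp (fun _ : Fin N → ℤ => F) q)
    (hy : ∀ k i, ‖y k i‖ = trap r (i - k) * ‖x i‖) :
    ∃ u : lp (fun _ : Fin N → ℤ => ℝ) q, (∀ k, u k = ‖y k‖) ∧
      ‖u‖ = (∑' j : Fin N → ℤ, trap r j ^ q.toReal) ^ (1 / q.toReal) * ‖x‖ := by
  have hsum : HasSum (fun k => ‖y k‖ ^ q.toReal)
      ((∑' j : Fin N → ℤ, trap r j ^ q.toReal) * ‖x‖ ^ q.toReal) := by
    refine hasSum_tsum_of_hasSum_conv (summable_trap_rpow hr hs).hasSum (lp.hasSum_norm hs x)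
      (fun j => Real.rpow_nonneg (trap_nonneg r j) _)
      (fun i => Real.rpow_nonneg (norm_nonneg (x i)) _) fun k => ?_
    have h1 := lp.hasSum_norm hs (y k)
    have h2 : ∀ i, ‖y k i‖ ^ q.toReal = trap r (i - k) ^ q.toReal * ‖x i‖ ^ q.toReal := fun i => by
      rw [hy, Real.mul_rpow (trap_nonneg r _) (norm_nonneg (x i))]
    simp only [h2] at h1
    exact h1
  have hnn : ∀ k, ‖(‖y k‖ : ℝ)‖ = ‖y k‖ := fun k => Real.norm_of_nonneg (lp.norm_nonneg' (y k))
  have hmem : Memℓp (E := fun _ : Fin N → ℤ => ℝ) (fun k => ‖y k‖) q :=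
    memℓp_gen (hsum.summable.congr fun k => by rw [hnn])
  refine ⟨⟨_, hmem⟩, fun k => rfl, ?_⟩
  rw [lp.norm_eq_tsum_rpow hs]
  have htsum : ∑' k, ‖(‖y k‖ : ℝ)‖ ^ q.toReal =
      (∑' j : Fin N → ℤ, trap r j ^ q.toReal) * ‖x‖ ^ q.toReal := by
    rw [← hsum.tsum_eq]
    exact tsum_congr fun k => by rw [hnn]
  change (∑' k, ‖(‖y k‖ : ℝ)‖ ^ q.toReal) ^ (1 / q.toReal) = _
  rw [htsum, Real.mul_rpow (tsum_trap_rpow_pos hr hs).le (Real.rpow_nonneg (lp.norm_nonneg' x) _),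
    one_div, Real.rpow_rpow_inv (lp.norm_nonneg' x) hs.ne']

/-- For finite exponents, interchanging the sums over centres and entries gives `g ^ q = ∑ trap ^
q`; for the supremum norm `g = 1`. The equality, with `g` independent of `x`, allows `g` to cancel
from estimates comparing two sequences. -/
theorem exists_norm_localization_lp {F : Type*} [NormedAddCommGroup F] {q : ℝ≥0∞}
    (hq : q ≠ 0) {r : ℝ} (hr : 0 < r) :
    ∃ g : ℝ, 0 < g ∧ ∀ (x : lp (fun _ : Fin N → ℤ => F) q)
      (y : (Fin N → ℤ) → lp (fun _ : Fin N → ℤ => F) q),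
      (∀ k i, ‖y k i‖ = trap r (i - k) * ‖x i‖) →
      ∃ u : lp (fun _ : Fin N → ℤ => ℝ) q, (∀ k, u k = ‖y k‖) ∧ ‖u‖ = g * ‖x‖ := by
  rcases q.trichotomy with rfl | rfl | hs
  · exact absurd rfl hq
  · refine ⟨1, one_pos, fun x y hy => ?_⟩
    rw [one_mul]
    exact exists_norm_localization_lp_top hr x y hy
  · exact ⟨_, Real.rpow_pos_of_pos (tsum_trap_rpow_pos hr hs) _,
      exists_norm_localization_lp_of_toReal_pos hs hr⟩

variable (N p E) in
theorem exists_norm_localization {r : ℝ} (hr : 0 < r) :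
    ∃ g : ℝ, 0 < g ∧ ∀ x : SeqSpace N p E,
      ∃ u : lp (fun _ : Fin N → ℤ => ℝ) (normExp p),
        (∀ k, u k = ‖trapOp p E r k x‖) ∧ ‖u‖ = g * ‖x‖ := by
  obtain ⟨g, hg, h⟩ := exists_norm_localization_lp (N := N) (F := E) (normExp_ne_zero p) hr
  exact ⟨g, hg, fun x => h x.1 (fun k => (trapOp p E r k x).1) fun k i =>
    norm_entry_trapOp r k x i⟩

/-! ### From local to global lower bounds -/

theorem norm_cut_le_sum {κ : Type*} (F : Finset κ) (S : κ → Set (Fin N → ℤ))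
    {S₀ : Set (Fin N → ℤ)} (h : ∀ i ∈ S₀, ∃ a ∈ F, i ∈ S a) (x : SeqSpace N p E) :
    ‖cut S₀ x‖ ≤ ∑ a ∈ F, ‖cut (S a) x‖ := by
  have h1 : ‖cut S₀ x‖ ≤ ‖∑ a ∈ F, normSeq (cut (S a) x)‖ := by
    rw [← norm_normSeq]
    refine lp.norm_mono (normExp_ne_zero p) fun i => ?_
    rw [lp.coeFn_sum, Finset.sum_apply, normSeq_apply, norm_norm]
    have hnn : ∀ a ∈ F, 0 ≤ normSeq (cut (S a) x) i := fun a _ => norm_nonneg _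
    by_cases hi : i ∈ S₀
    · obtain ⟨a, ha, hia⟩ := h i hi
      refine le_trans ?_ (le_abs_self _)
      rw [entry_cut_of_mem hi, ← entry_cut_of_mem hia]
      exact Finset.single_le_sum hnn ha
    · rw [entry_cut_of_notMem hi, norm_zero]
      exact norm_nonneg _
  refine h1.trans ((norm_sum_le _ _).trans_eq (Finset.sum_congr rfl fun a _ => norm_normSeq _))

/-- The multiples `r e` of the integer vectors with entries in `{-3, …, 3}`. -/
def cover (N : ℕ) (r : ℕ) : Finset (Fin N → ℤ) :=
  (Fintype.piFinset fun _ : Fin N => Finset.Icc (-3 : ℤ) 3).image fun e j => (r : ℤ) * e j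

theorem card_cover_le (N r : ℕ) : (cover N r).card ≤ 7 ^ N := by
  refine Finset.card_image_le.trans_eq ?_
  rw [Fintype.card_piFinset, Finset.prod_const, Finset.card_univ, Fintype.card_fin]
  rfl

theorem exists_mem_cover {r : ℕ} (hr : 0 < r) {k i : Fin N → ℤ}
    (hi : i ∈ box k (3 * r : ℝ)) : ∃ α ∈ cover N r, i ∈ box (k - α) (r : ℝ) := by
  have hr' : (0 : ℤ) < r := by exact_mod_cast hr
  have hij : ∀ j, |i j - k j| ≤ 3 * (r : ℤ) := fun j => by
    have := (norm_le_pi_norm (i - k) j).trans hi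
    rw [Pi.sub_apply, Int.norm_eq_abs] at this
    exact_mod_cast this
  -- The offset is `k - i` rounded down to the grid `r ℤ^N`; the remainder lies in `[0, r)` in each
  -- coordinate.
  refine ⟨fun j => (r : ℤ) * ((k j - i j) / r), Finset.mem_image.2
    ⟨fun j => (k j - i j) / r, Fintype.mem_piFinset.2 fun j => ?_, rfl⟩, ?_⟩
  · have := abs_le.1 (hij j)
    rw [Finset.mem_Icc]
    constructor
    · rw [Int.le_ediv_iff_mul_le hr']; linarith
    · have : (k j - i j) / (r : ℤ) < 4 := by
        rw [Int.ediv_lt_iff_lt_mul hr']; linarith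
      omega
  · rw [mem_box, pi_norm_le_iff_of_nonneg (Nat.cast_nonneg r)]
    intro j
    have h1 := Int.emod_add_mul_ediv (k j - i j) r
    have h2 := Int.emod_nonneg (k j - i j) hr'.ne'
    have h3 := Int.emod_lt_of_pos (k j - i j) hr'
    rw [Int.norm_eq_abs, ← Int.cast_abs]
    have : |(i - (k - fun j => (r : ℤ) * ((k j - i j) / r))) j| ≤ (r : ℤ) := by
      simp only [Pi.sub_apply]
      rw [abs_le]
      constructor <;> linarith
    exact_mod_cast this

theorem norm_cut_box_le_norm_trapOp {r : ℝ} (hr : 0 < r) (k : Fin N → ℤ) (x : SeqSpace N p E) :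
    ‖cut (box k r) x‖ ≤ ‖trapOp p E r k x‖ := by
  refine norm_mono fun i => ?_
  by_cases hi : i ∈ box k r
  · rw [entry_cut_of_mem hi, norm_entry_trapOp, trap_eq_one hr hi, one_mul]
  · rw [entry_cut_of_notMem hi, norm_zero]
    exact norm_nonneg _

theorem HasPropagation.commutator_mul_cut {A : SeqSpace N p E →L[ℂ] SeqSpace N p E} {w : ℝ}
    (hA : HasPropagation A w) (hw : 0 ≤ w) {r R : ℝ} (hr : 0 < r) (hR : 2 * r + w ≤ R)
    (k : Fin N → ℤ) :
    (A * trapOp p E r k - trapOp p E r k * A) * cut (box k R) =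
      A * trapOp p E r k - trapOp p E r k * A := by
  have h1 : trapOp p E r k * cut (box k R) = trapOp p E r k :=
    trapOp_mul_cut_of_subset hr fun i hi => (mem_box.1 hi).trans (by linarith)
  have h2 : trapOp p E r k * A * cut (box k R)ᶜ = 0 := by
    rw [← trapOp_mul_cut_of_subset hr (S := box k (2 * r)) subset_rfl, mul_assoc _ (cut _) A,
      mul_assoc]
    rw [hA.cut_mul_mul_cut_eq_zero, mul_zero]
    intro i hi j hj hij
    refine hj ?_
    rw [mem_box] at *
    have : ‖j - k‖ ≤ ‖j - i‖ + ‖i - k‖ := by simpa using norm_add_le (j - i) (i - k)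
    linarith
  rw [← one_sub_cut, mul_sub, mul_one, sub_eq_zero] at h2
  rw [sub_mul, mul_assoc, h1, ← h2]

/-- Apply the local bound to the pieces `trapOp r k x` and take the `lp` norm over `k`. The
commutators acting on neighbouring pieces add up to at most `7 ^ N * κ / r` times the norm, so a
large `r` costs little. Here `R` depends on `δ` and `A` only, not on `F` or `ν`. -/
theorem _root_.IsBandDominated.exists_lower_bound {A : SeqSpace N p E →L[ℂ] SeqSpace N p E}
    (hA : IsBandDominated A) {δ : ℝ} (hδ : 0 < δ) :
    ∃ R : ℝ, ∀ (F : Set (Fin N → ℤ)) (ν : ℝ),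
      (∀ k x, (∀ i ∉ F ∩ box k R, entry x i = 0) → ν * ‖x‖ ≤ ‖A x‖) →
      ∀ x, (∀ i ∉ F, entry x i = 0) → (ν - δ) * ‖x‖ ≤ ‖A x‖ := by
  obtain ⟨A', hA', hAA'⟩ := hA.exists_band (show 0 < δ / 4 by positivity)
  obtain ⟨w, hw, hprop⟩ := hA'.exists_hasPropagation
  obtain ⟨κ, hκ, hcomm⟩ := hA'.exists_norm_commutator_le
  obtain ⟨n, hn⟩ := exists_nat_ge (w + κ * 7 ^ N * 4 / δ)
  have hκ0 : 0 ≤ κ * 7 ^ N * 4 / δ := by positivity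
  set r : ℕ := n + 1 with hrdef
  have hr1 : w + κ * 7 ^ N * 4 / δ ≤ r := by rw [hrdef]; push_cast; linarith
  have hr : (0 : ℝ) < r := by positivity
  refine ⟨2 * r, fun F ν hloc x hx => ?_⟩
  -- The remaining case has `ν - δ / 4 > 0`, needed to take norms of a multiple of `u`.
  rcases le_or_gt ν δ with hνδ | hνδ
  · exact (mul_nonpos_of_nonpos_of_nonneg (by linarith) (norm_nonneg _)).trans (norm_nonneg _)
  obtain ⟨g, hg, hgx⟩ := exists_norm_localization N p E hr
  obtain ⟨u, hu, hug⟩ := hgx x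
  obtain ⟨v, hv, hvg⟩ := hgx (A' x)
  have hAdiff : ∀ y, ‖A y - A' y‖ ≤ δ / 4 * ‖y‖ := fun y =>
    (A - A').le_of_opNorm_le hAA'.le y
  have hpt : ∀ k, (ν - δ / 4) * u k ≤ v k + ∑ α ∈ cover N r, κ / r * u (k - α) := by
    intro k
    simp only [hu, hv]
    have h1 : ν * ‖trapOp p E r k x‖ ≤ ‖A (trapOp p E r k x)‖ := by
      refine hloc k _ fun i hi => ?_
      rw [entry_trapOp]
      by_cases hiF : i ∈ F
      · have : ¬ ‖i - k‖ ≤ 2 * r := fun h => hi ⟨hiF, h⟩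
        rw [trap_eq_zero hr (not_le.1 this).le, Complex.ofReal_zero, zero_smul]
      · rw [hx i hiF, smul_zero]
    have h2 : ‖A (trapOp p E r k x)‖ ≤ ‖A' (trapOp p E r k x)‖ + δ / 4 * ‖trapOp p E r k x‖ := by
      have := norm_add_le (A' (trapOp p E r k x))
        (A (trapOp p E r k x) - A' (trapOp p E r k x))
      rw [add_sub_cancel] at this
      linarith [hAdiff (trapOp p E r k x)]
    -- The commutator sees only `box k (3 * r)`, which is covered by boxes of radius `r` on which
    -- the neighbouring trapezoidal functions equal `1`.
    have h3 : A' (trapOp p E r k x) - trapOp p E r k (A' x) =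
        (A' * trapOp p E r k - trapOp p E r k * A') (cut (box k (3 * r)) x) := by
      have := congrArg (fun T : SeqSpace N p E →L[ℂ] SeqSpace N p E => T x)
        (hprop.commutator_mul_cut hw hr (R := 3 * r) (by linarith) k)
      exact this.symm
    have h4 : ‖A' (trapOp p E r k x) - trapOp p E r k (A' x)‖ ≤
        κ / r * ∑ α ∈ cover N r, ‖trapOp p E r (k - α) x‖ := by
      rw [h3]
      refine (ContinuousLinearMap.le_of_opNorm_le _ (hcomm r hr k) _).trans ?_
      gcongr
      refine (norm_cut_le_sum (cover N r) (fun α => box (k - α) r)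
        (fun i hi => exists_mem_cover (Nat.succ_pos n) hi) x).trans ?_
      gcongr with α hα
      exact norm_cut_box_le_norm_trapOp hr _ _
    have h5 := norm_add_le (trapOp p E r k (A' x))
      (A' (trapOp p E r k x) - trapOp p E r k (A' x))
    rw [add_sub_cancel] at h5
    rw [← Finset.mul_sum]
    linarith
  have hnorm : ‖(ν - δ / 4) • u‖ ≤ ‖v + ∑ α ∈ cover N r, (κ / r) • lpShift α u‖ := by
    refine lp.norm_mono (normExp_ne_zero p) fun k => ?_
    have hun : 0 ≤ u k := by rw [hu]; exact norm_nonneg _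
    rw [lp.coeFn_smul, lp.coeFn_add, lp.coeFn_sum, Pi.smul_apply, Pi.add_apply,
      Finset.sum_apply, smul_eq_mul, Real.norm_of_nonneg (mul_nonneg (by linarith) hun)]
    exact (hpt k).trans (le_abs_self _)
  rw [norm_smul, Real.norm_of_nonneg (by linarith)] at hnorm
  have hsum : ‖v + ∑ α ∈ cover N r, (κ / r) • lpShift α u‖ ≤ ‖v‖ + 7 ^ N * (κ / r * ‖u‖) := by
    refine (norm_add_le _ _).trans (add_le_add_right ((norm_sum_le _ _).trans ?_) _)
    have h1 : ∀ α ∈ cover N r, ‖(κ / r : ℝ) • lpShift α u‖ = κ / r * ‖u‖ := fun α _ => by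
      rw [norm_smul, Real.norm_of_nonneg (by positivity), norm_lpShift (normExp_ne_zero p)]
    rw [Finset.sum_congr rfl h1, Finset.sum_const, nsmul_eq_mul]
    gcongr
    exact_mod_cast card_cover_le N r
  have hκr : 7 ^ N * (κ / r) ≤ δ / 4 := by
    rw [← mul_div_assoc, div_le_iff₀ hr]
    have : κ * 7 ^ N * 4 / δ ≤ r := by linarith
    rw [div_le_iff₀ hδ] at this
    linarith
  have hmain := hnorm.trans hsum
  rw [hug, hvg] at hmain
  -- The normalizing constant `g` cancels here.
  have hmain' : (ν - δ / 4) * ‖x‖ ≤ ‖A' x‖ + 7 ^ N * (κ / r) * ‖x‖ := by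
    refine le_of_mul_le_mul_left ?_ hg
    linarith
  have h6 : ‖A' x‖ ≤ ‖A x‖ + δ / 4 * ‖x‖ := by
    have := norm_sub_le (A x) (A x - A' x)
    rw [sub_sub_cancel] at this
    linarith [hAdiff x]
  have h7 : 7 ^ N * (κ / r) * ‖x‖ ≤ δ / 4 * ‖x‖ := by gcongr
  have h8 : 0 ≤ δ / 4 * ‖x‖ := by positivity
  linarith

/-! ### Sums of operators with boundedly overlapping ranges -/

/-- The inputs `v a` are cut from `y` along disjoint sets, so their `q`-th powers sum to at most
that of `y`. The outputs may overlap, but each entry of `s` is controlled by one `z a`, at the cost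
of the factor `M`. -/
theorem lp_norm_le_of_overlap {F κ : Type*} [NormedAddCommGroup F] [DecidableEq κ] {q : ℝ≥0∞}
    (hq : q ≠ 0) (S : Finset κ) (π : (Fin N → ℤ) → κ)
    (z v : κ → lp (fun _ : Fin N → ℤ => F) q) (s y : lp (fun _ : Fin N → ℤ => F) q) {M η : ℝ}
    (hM : 0 ≤ M) (hη : 0 ≤ η) (hs : ∀ i, s i = 0 ∨ ∃ a ∈ S, ‖s i‖ ≤ M * ‖z a i‖)
    (hz : ∀ a ∈ S, ‖z a‖ ≤ η * ‖v a‖) (hv : ∀ a i, ‖v a i‖ = if π i = a then ‖y i‖ else 0) :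
    ‖s‖ ≤ M * η * ‖y‖ := by
  have hnn : 0 ≤ M * η * ‖y‖ := mul_nonneg (mul_nonneg hM hη) (lp.norm_nonneg' y)
  have hvle : ∀ a i, ‖v a i‖ ≤ ‖y i‖ := fun a i => by
    rw [hv]
    split_ifs
    exacts [le_rfl, norm_nonneg _]
  rcases q.trichotomy with rfl | rfl | hq'
  · exact absurd rfl hq
  · refine lp.norm_le_of_forall_le hnn fun i => ?_
    rcases hs i with h | ⟨a, ha, h⟩
    · rw [h, norm_zero]; exact hnn
    · refine h.trans ?_
      rw [mul_assoc]
      gcongr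
      refine (lp.norm_apply_le_norm hq (z a) i).trans ((hz a ha).trans ?_)
      gcongr
      exact lp.norm_mono hq (hvle a)
  · have hvs : ∑ a ∈ S, ‖v a‖ ^ q.toReal ≤ ‖y‖ ^ q.toReal := by
      refine hasSum_le (fun i => ?_) (hasSum_sum fun a _ => lp.hasSum_norm hq' (v a))
        (lp.hasSum_norm hq' y)
      have h1 : ∀ a ∈ S, ‖v a i‖ ^ q.toReal = if π i = a then ‖y i‖ ^ q.toReal else 0 := by
        intro a _
        rw [hv]
        split_ifs
        · rfl
        · exact Real.zero_rpow hq'.ne'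
      rw [Finset.sum_congr rfl h1, Finset.sum_ite_eq]
      split_ifs
      · exact le_rfl
      · exact Real.rpow_nonneg (norm_nonneg _) _
    have hzs : HasSum (fun i => M ^ q.toReal * ∑ a ∈ S, ‖z a i‖ ^ q.toReal)
        (M ^ q.toReal * ∑ a ∈ S, ‖z a‖ ^ q.toReal) :=
      (hasSum_sum fun a _ => lp.hasSum_norm hq' (z a)).mul_left _
    have hsz : ‖s‖ ^ q.toReal ≤ M ^ q.toReal * ∑ a ∈ S, ‖z a‖ ^ q.toReal := by
      refine hasSum_le (fun i => ?_) (lp.hasSum_norm hq' s) hzs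
      have hsum : 0 ≤ ∑ a ∈ S, ‖z a i‖ ^ q.toReal :=
        Finset.sum_nonneg fun a _ => Real.rpow_nonneg (norm_nonneg _) _
      rcases hs i with h | ⟨a, ha, h⟩
      · rw [h, norm_zero, Real.zero_rpow hq'.ne']
        exact mul_nonneg (Real.rpow_nonneg hM _) hsum
      · refine (Real.rpow_le_rpow (norm_nonneg _) h hq'.le).trans ?_
        rw [Real.mul_rpow hM (norm_nonneg _)]
        refine mul_le_mul_of_nonneg_left ?_ (Real.rpow_nonneg hM _)
        exact Finset.single_le_sum (f := fun a => ‖z a i‖ ^ q.toReal)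
          (fun a _ => Real.rpow_nonneg (norm_nonneg _) _) ha
    have hzv : ∑ a ∈ S, ‖z a‖ ^ q.toReal ≤ η ^ q.toReal * ‖y‖ ^ q.toReal := by
      refine le_trans ?_ (mul_le_mul_of_nonneg_left hvs (Real.rpow_nonneg hη _))
      rw [Finset.mul_sum]
      refine Finset.sum_le_sum fun a ha => ?_
      rw [← Real.mul_rpow hη (lp.norm_nonneg' _)]
      exact Real.rpow_le_rpow (lp.norm_nonneg' _) (hz a ha) hq'.le
    refine (Real.rpow_le_rpow_iff (lp.norm_nonneg' s) hnn hq').1 ?_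
    rw [Real.mul_rpow (mul_nonneg hM hη) (lp.norm_nonneg' y), Real.mul_rpow hM hη, mul_assoc]
    exact hsz.trans (mul_le_mul_of_nonneg_left hzv (Real.rpow_nonneg hM _))

/-- With at most `M` nonzero terms, the sum is bounded by `M` times the largest; this supplies the
pointwise hypothesis of `lp_norm_le_of_overlap`. -/
theorem norm_sum_eq_zero_or_le {κ F : Type*} [NormedAddCommGroup F] (S : Finset κ) (f : κ → F)
    {M : ℕ} (G : Finset κ) (hG : G.card ≤ M) (h : ∀ a ∈ S, f a ≠ 0 → a ∈ G) :
    ∑ a ∈ S, f a = 0 ∨ ∃ a ∈ S, ‖∑ a ∈ S, f a‖ ≤ M * ‖f a‖ := by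
  classical
  have h1 : ∑ a ∈ S, f a = ∑ a ∈ S with f a ≠ 0, f a := (Finset.sum_filter_ne_zero S).symm
  rcases (S.filter fun a => f a ≠ 0).eq_empty_or_nonempty with he | hne
  · left; rw [h1, he, Finset.sum_empty]
  · right
    obtain ⟨a, ha, hmax⟩ := Finset.exists_max_image _ (fun a => ‖f a‖) hne
    refine ⟨a, (Finset.mem_filter.1 ha).1, ?_⟩
    rw [h1]
    refine (norm_sum_le_of_le _ hmax).trans ?_
    rw [Finset.sum_const, nsmul_eq_mul]
    gcongr
    refine (Finset.card_le_card fun b hb => ?_).trans hG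
    exact h b (Finset.mem_filter.1 hb).1 (Finset.mem_filter.1 hb).2

/-- The index of the cube of side `r` that contains `i`. -/
def cubeIndex (r : ℕ) (i : Fin N → ℤ) : Fin N → ℤ := fun j => i j / r

/-- The cube of side `r` with index `m`. -/
def cube (r : ℕ) (m : Fin N → ℤ) : Set (Fin N → ℤ) := {i | cubeIndex r i = m}

/-- The corner of the cube of side `r` with index `m`. -/
def corner (r : ℕ) (m : Fin N → ℤ) : Fin N → ℤ := fun j => r * m j

theorem mem_cube {r : ℕ} {m i : Fin N → ℤ} : i ∈ cube r m ↔ cubeIndex r i = m := Iff.rfl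

theorem norm_le_norm_corner {r : ℕ} (hr : 0 < r) (m : Fin N → ℤ) : ‖m‖ ≤ ‖corner r m‖ := by
  rw [pi_norm_le_iff_of_nonneg (norm_nonneg _)]
  intro j
  refine le_trans ?_ (norm_le_pi_norm _ j)
  rw [corner, Int.norm_eq_abs, Int.norm_eq_abs, Int.cast_mul, abs_mul, Int.cast_natCast,
    Nat.abs_cast]
  exact le_mul_of_one_le_left (abs_nonneg _) (by exact_mod_cast hr)

theorem cube_subset_box {r : ℕ} (hr : 0 < r) (m : Fin N → ℤ) :
    cube r m ⊆ box (corner r m) r := by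
  rintro i rfl
  rw [mem_box, pi_norm_le_iff_of_nonneg (Nat.cast_nonneg r)]
  intro j
  have hr' : (0 : ℤ) < r := by exact_mod_cast hr
  have h1 := Int.emod_add_mul_ediv (i j) r
  have h2 := Int.emod_nonneg (i j) hr'.ne'
  have h3 := Int.emod_lt_of_pos (i j) hr'
  have : |(i - corner r (cubeIndex r i)) j| ≤ (r : ℤ) := by
    simp only [Pi.sub_apply, corner, cubeIndex]
    rw [abs_le]
    constructor <;> linarith
  rw [Int.norm_eq_abs, ← Int.cast_abs]
  exact_mod_cast this

/-- The indices of the cubes close to `i`. -/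
def nearIndices (r : ℕ) (i : Fin N → ℤ) : Finset (Fin N → ℤ) :=
  Fintype.piFinset fun j => Finset.Icc (i j / r - 3) (i j / r + 3)

theorem card_nearIndices_le (r : ℕ) (i : Fin N → ℤ) : (nearIndices r i).card ≤ 7 ^ N := by
  rw [nearIndices, Fintype.card_piFinset]
  refine (Finset.prod_le_pow_card _ _ 7 fun j _ => ?_).trans_eq (by simp)
  rw [Int.card_Icc]
  omega

theorem mem_nearIndices {r : ℕ} (hr : 0 < r) {i m : Fin N → ℤ}
    (h : i ∈ box (corner r m) (3 * r : ℝ)) : m ∈ nearIndices r i := by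
  have hr' : (0 : ℤ) < r := by exact_mod_cast hr
  refine Fintype.mem_piFinset.2 fun j => ?_
  have hj : |i j - r * m j| ≤ 3 * (r : ℤ) := by
    have := (norm_le_pi_norm (i - corner r m) j).trans h
    rw [Pi.sub_apply, Int.norm_eq_abs, corner] at this
    exact_mod_cast this
  have hj' := abs_le.1 hj
  rw [Finset.mem_Icc]
  constructor
  · have : i j / (r : ℤ) < m j + 4 := by
      rw [Int.ediv_lt_iff_lt_mul hr']; nlinarith
    linarith
  · have : m j - 3 ≤ i j / (r : ℤ) := by
      rw [Int.le_ediv_iff_mul_le hr']; linarith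
    linarith

theorem norm_le_of_cube_overlap {r : ℕ} (S : Finset (Fin N → ℤ))
    (z : (Fin N → ℤ) → SeqSpace N p E) (s y : SeqSpace N p E) {M η : ℝ} (hM : 0 ≤ M)
    (hη : 0 ≤ η) (hs : ∀ i, entry s i = 0 ∨ ∃ m ∈ S, ‖entry s i‖ ≤ M * ‖entry (z m) i‖)
    (hz : ∀ m ∈ S, ‖z m‖ ≤ η * ‖cut (cube r m) y‖) : ‖s‖ ≤ M * η * ‖y‖ := by
  have hv : ∀ m i, ‖entry (cut (cube r m) y) i‖ =
      if cubeIndex r i = m then ‖entry y i‖ else 0 := fun m i => by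
    split_ifs with h
    · rw [entry_cut_of_mem (mem_cube.2 h)]
    · rw [entry_cut_of_notMem (fun h' => h (mem_cube.1 h')), norm_zero]
  exact lp_norm_le_of_overlap (normExp_ne_zero p) S (cubeIndex r) (fun m => (z m).1)
    (fun m => (cut (cube r m) y).1) s.1 y.1 hM hη hs hz hv

/-- A point lies in at most `7 ^ N` of the output boxes. The radius is `3 r`, not `2 r`, so that the
bound also applies after a band operator has widened the blocks. -/
theorem norm_sum_block_le {r : ℕ} (hr : 0 < r) (S : Finset (Fin N → ℤ))
    (Z : (Fin N → ℤ) → SeqSpace N p E →L[ℂ] SeqSpace N p E) {η : ℝ}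
    (hl : ∀ m, cut (box (corner r m) (3 * r)) * Z m = Z m)
    (hc : ∀ m, Z m * cut (cube r m) = Z m) (hη : ∀ m, ‖Z m‖ ≤ η) :
    ‖∑ m ∈ S, Z m‖ ≤ 7 ^ N * η := by
  have hη0 : 0 ≤ η := (norm_nonneg _).trans (hη 0)
  refine ContinuousLinearMap.opNorm_le_bound _ (by positivity) fun y => ?_
  have hz : ∀ m ∈ S, ‖Z m y‖ ≤ η * ‖cut (cube r m) y‖ := fun m _ => by
    have h : Z m (cut (cube r m) y) = Z m y :=
      congrArg (fun T : SeqSpace N p E →L[ℂ] SeqSpace N p E => T y) (hc m)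
    rw [← h]
    exact (Z m).le_of_opNorm_le (hη m) _
  refine norm_le_of_cube_overlap S (fun m => Z m y) _ y (by positivity) hη0 (fun i => ?_) hz
  have h1 := norm_sum_eq_zero_or_le S (fun m => entry (Z m y) i) (nearIndices r i)
    (card_nearIndices_le r i) fun m _ hm => by
      refine mem_nearIndices hr ?_
      by_contra hi
      refine hm ?_
      rw [← hl m]
      exact entry_cut_of_notMem hi _
  rw [sum_apply, entry_sum]
  rwa [Nat.cast_pow, Nat.cast_ofNat] at h1

/-- The indices in the box of radius `n`. -/
def boxFinset (N : ℕ) (n : ℕ) : Finset (Fin N → ℤ) := (finite_box 0 (n : ℝ)).toFinset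

theorem mem_boxFinset {n : ℕ} {m : Fin N → ℤ} : m ∈ boxFinset N n ↔ ‖m‖ ≤ n := by
  rw [boxFinset, Set.Finite.mem_toFinset, mem_box, sub_zero]

theorem boxFinset_mono {n k : ℕ} (h : n ≤ k) : boxFinset N n ⊆ boxFinset N k := fun m hm =>
  mem_boxFinset.2 ((mem_boxFinset.1 hm).trans (by exact_mod_cast h))

theorem sum_boxFinset_sub_eq_zero {R : Type*} [NonUnitalRing R] (T : (Fin N → ℤ) → R)
    (L L' : R) {n₀ : ℕ} (h : ∀ m, (n₀ : ℝ) < ‖m‖ → L * T m * L' = 0) {n k : ℕ} (hn : n₀ ≤ n)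
    (hk : n₀ ≤ k) :
    L * (∑ m ∈ boxFinset N n, T m - ∑ m ∈ boxFinset N k, T m) * L' = 0 := by
  have h1 : ∀ n ≥ n₀, L * (∑ m ∈ boxFinset N n, T m) * L' =
      L * (∑ m ∈ boxFinset N n₀, T m) * L' := by
    intro n hn
    rw [Finset.mul_sum, Finset.sum_mul, Finset.mul_sum, Finset.sum_mul]
    refine (Finset.sum_subset (boxFinset_mono hn) fun m _ hm => h m ?_).symm
    rw [mem_boxFinset, not_le] at hm
    exact hm
  rw [mul_sub, sub_mul, h1 n hn, h1 k hk, sub_self]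

/-- On each fixed box the partial sums are eventually constant from both sides, so the limit exists
although the series need not converge in norm. The bounded propagation of `C` puts it in `L(X, P)`.
-/
theorem exists_block_sum [CompleteSpace E] {r : ℕ} (hr : 0 < r)
    (T : (Fin N → ℤ) → SeqSpace N p E →L[ℂ] SeqSpace N p E) {t : ℝ}
    (hl : ∀ m, cut (box (corner r m) (2 * r)) * T m = T m)
    (hc : ∀ m, T m * cut (cube r m) = T m) (ht : ∀ m, ‖T m‖ ≤ t) :
    ∃ C : SeqSpace N p E →L[ℂ] SeqSpace N p E, ‖C‖ ≤ 7 ^ N * t ∧ HasPropagation C (3 * r) ∧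
      ∀ j : ℕ, ∃ n₀, ∀ n ≥ n₀, cut (box 0 j) * (∑ m ∈ boxFinset N n, T m - C) = 0 := by
  have hr0 : (0 : ℝ) < r := by exact_mod_cast hr
  have hl3 : ∀ m, cut (box (corner r m) (3 * r)) * T m = T m := fun m => by
    rw [← hl m, ← mul_assoc, cut_mul_cut, Set.inter_eq_right.2]
    exact fun i hi => (mem_box.1 hi).trans (by linarith)
  have hleft : ∀ (j : ℕ) m, ((2 * r + j : ℕ) : ℝ) < ‖m‖ → cut (box 0 j) * T m = 0 := by
    intro j m hm
    rw [← hl m, ← mul_assoc, cut_mul_cut]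
    have : (box 0 j ∩ box (corner r m) (2 * r) : Set (Fin N → ℤ)) = ∅ := by
      rw [Set.eq_empty_iff_forall_notMem]
      rintro i ⟨h1, h2⟩
      rw [mem_box, sub_zero] at h1
      rw [mem_box] at h2
      have h3 := norm_sub_le i (i - corner r m)
      rw [sub_sub_cancel] at h3
      have h4 := norm_le_norm_corner hr m
      push_cast at hm
      linarith
    rw [this, cut_empty, zero_mul]
  have hright : ∀ (j : ℕ) m, ((2 * r + j : ℕ) : ℝ) < ‖m‖ → T m * cut (box 0 j) = 0 := by
    intro j m hm
    rw [← hc m, mul_assoc, cut_mul_cut]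
    have : (cube r m ∩ box 0 j : Set (Fin N → ℤ)) = ∅ := by
      rw [Set.eq_empty_iff_forall_notMem]
      rintro i ⟨h2, h1⟩
      rw [mem_box, sub_zero] at h1
      have h2 := mem_box.1 (cube_subset_box hr m h2)
      have h3 := norm_sub_le i (i - corner r m)
      rw [sub_sub_cancel] at h3
      have h4 := norm_le_norm_corner hr m
      push_cast at hm
      linarith
    rw [this, cut_empty, mul_zero]
  have hconst : ∀ (j : ℕ) {n k : ℕ}, 2 * r + j ≤ n → 2 * r + j ≤ k →
      cut (box 0 j) * (∑ m ∈ boxFinset N n, T m - ∑ m ∈ boxFinset N k, T m) = 0 := by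
    intro j n k hn hk
    have := sum_boxFinset_sub_eq_zero T (cut (box 0 j)) 1 (n₀ := 2 * r + j)
      (fun m hm => by rw [hleft j m hm, zero_mul]) hn hk
    rwa [mul_one] at this
  have hconst' : ∀ (j : ℕ) {n k : ℕ}, 2 * r + j ≤ n → 2 * r + j ≤ k →
      (∑ m ∈ boxFinset N n, T m - ∑ m ∈ boxFinset N k, T m) * cut (box 0 j) = 0 := by
    intro j n k hn hk
    have := sum_boxFinset_sub_eq_zero T 1 (cut (box 0 j)) (n₀ := 2 * r + j)
      (fun m hm => by rw [one_mul, hright j m hm]) hn hk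
    rwa [one_mul] at this
  obtain ⟨C, hCt, hC⟩ := exists_pLimit (T := fun n => ∑ m ∈ boxFinset N n, T m)
    (fun n => norm_sum_block_le hr _ T hl3 hc ht)
    (fun j δ hδ => ⟨2 * r + j, fun n hn k hk => by rw [hconst j hn hk, norm_zero]; exact hδ.le⟩)
    (fun j δ hδ => ⟨2 * r + j, fun n hn k hk => by rw [hconst' j hn hk, norm_zero]; exact hδ.le⟩)
  have hlim : ∀ j : ℕ, ∀ n ≥ 2 * r + j, cut (box 0 j) * (∑ m ∈ boxFinset N n, T m - C) = 0 := by
    intro j n hn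
    rw [← norm_le_zero_iff]
    refine le_of_forall_pos_le_add fun δ hδ => ?_
    obtain ⟨n₀, hn₀⟩ := hC j δ hδ
    have h1 := hconst j hn (le_max_right n₀ (2 * r + j))
    have h2 := hn₀ _ (le_max_left n₀ (2 * r + j))
    rw [mul_sub, sub_eq_zero] at h1
    rw [zero_add, mul_sub, h1, ← mul_sub]
    exact h2
  refine ⟨C, hCt, fun x i hx => ?_, fun j => ⟨_, hlim j⟩⟩
  have hi := mem_box_zero_natCeil i
  have h1 := hlim ⌈‖i‖⌉₊ _ le_rfl
  rw [mul_sub, sub_eq_zero] at h1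
  have h2 : cut (box 0 (⌈‖i‖⌉₊ : ℕ)) ((∑ m ∈ boxFinset N (2 * r + ⌈‖i‖⌉₊), T m) x) =
      cut (box 0 (⌈‖i‖⌉₊ : ℕ)) (C x) :=
    congrArg (fun T : SeqSpace N p E →L[ℂ] SeqSpace N p E => T x) h1
  rw [← entry_cut_of_mem hi, ← h2, entry_cut_of_mem hi, sum_apply, entry_sum]
  refine Finset.sum_eq_zero fun m _ => ?_
  by_cases him : i ∈ box (corner r m) (2 * r : ℝ)
  · have h3 : cut (cube r m) x = 0 := by
      refine ext fun j => ?_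
      by_cases hj : j ∈ cube r m
      · rw [entry_cut_of_mem hj, entry_zero]
        refine hx j ?_
        have h4 := mem_box.1 (cube_subset_box hr m hj)
        have h5 := norm_sub_le (j - corner r m) (i - corner r m)
        rw [sub_sub_sub_cancel_right] at h5
        rw [mem_box] at him ⊢
        linarith
      · rw [entry_cut_of_notMem hj, entry_zero]
    have h4 : T m x = T m (cut (cube r m) x) :=
      (congrArg (fun T : SeqSpace N p E →L[ℂ] SeqSpace N p E => T x) (hc m)).symm
    rw [h4, h3, map_zero, entry_zero]
  · have h4 : T m x = cut (box (corner r m) (2 * r)) (T m x) :=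
      (congrArg (fun T : SeqSpace N p E →L[ℂ] SeqSpace N p E => T x) (hl m)).symm
    rw [h4, entry_cut_of_notMem him]

theorem norm_le_of_norm_cut_mul_le {T : SeqSpace N p E →L[ℂ] SeqSpace N p E} {c : ℝ} (hc : 0 ≤ c)
    (h : ∀ j : ℕ, ‖cut (box 0 j) * T‖ ≤ c) : ‖T‖ ≤ c := by
  refine ContinuousLinearMap.opNorm_le_bound _ hc fun x => ?_
  refine norm_le_of_tendsto_entry (x := fun j : ℕ => cut (box 0 j) (T x)) (fun j => ?_)
    fun i => ?_
  · exact ContinuousLinearMap.le_of_opNorm_le _ (h j) x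
  · refine tendsto_const_nhds.congr' (eventually_atTop.2 ⟨⌈‖i‖⌉₊, fun j hj => ?_⟩)
    refine (entry_cut_of_mem ?_ _).symm
    refine (mem_box.1 (mem_box_zero_natCeil i)).trans ?_
    exact_mod_cast hj

/-- A band operator applied to a sum of blocks. -/
theorem HasPropagation.norm_mul_sub_cut_le {A C : SeqSpace N p E →L[ℂ] SeqSpace N p E} {w : ℝ}
    (hA : HasPropagation A w) {r : ℕ} (hr : 0 < r) (hwr : w ≤ r)
    {T : (Fin N → ℤ) → SeqSpace N p E →L[ℂ] SeqSpace N p E}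
    (hl : ∀ m, cut (box (corner r m) (2 * r)) * T m = T m)
    (hc : ∀ m, T m * cut (cube r m) = T m)
    (hC : ∀ j : ℕ, ∃ n₀, ∀ n ≥ n₀, cut (box 0 j) * (∑ m ∈ boxFinset N n, T m - C) = 0)
    (Λ : Set (Fin N → ℤ)) {η : ℝ} (hη0 : 0 ≤ η)
    (hη : ∀ m ∈ Λ, ‖A * T m - cut (cube r m)‖ ≤ η) (hΛ : ∀ m ∉ Λ, T m = 0) :
    ‖A * C - cut {i | cubeIndex r i ∈ Λ}‖ ≤ 7 ^ N * η := by
  classical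
  set ψ : (Fin N → ℤ) → SeqSpace N p E →L[ℂ] SeqSpace N p E :=
    fun m => if m ∈ Λ then cut (cube r m) else 0 with hψ
  refine norm_le_of_norm_cut_mul_le (by positivity) fun j => ?_
  obtain ⟨s, hs⟩ := exists_nat_ge w
  obtain ⟨n₀, hn₀⟩ := hC (j + s)
  set n := max n₀ j
  -- Seen from `box 0 j`, the operator `A` reads only `box 0 (j + s)`, where the partial sum already
  -- equals `C`.
  have hfar : cut (box 0 j) * A * cut (box 0 (j + s : ℕ))ᶜ = 0 := by
    refine hA.cut_mul_mul_cut_eq_zero fun i hi k hk hik => hk ?_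
    rw [mem_box, sub_zero] at *
    have := norm_add_le (k - i) i
    rw [sub_add_cancel] at this
    push_cast
    linarith
  have h1 : cut (box 0 j) * A * C = cut (box 0 j) * A * ∑ m ∈ boxFinset N n, T m := by
    have h0 := hn₀ n (le_max_left _ _)
    rw [← one_sub_cut, mul_sub, mul_one, sub_eq_zero] at hfar
    rw [mul_sub, sub_eq_zero] at h0
    rw [hfar, mul_assoc _ (cut _) C, mul_assoc _ (cut _) (∑ m ∈ _, _), h0]
  have h2 : cut (box 0 j) * cut {i | cubeIndex r i ∈ Λ} =
      cut (box 0 j) * ∑ m ∈ boxFinset N n, ψ m := by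
    ext x : 1
    refine ext fun i => ?_
    change entry (cut (box 0 j) (cut {i | cubeIndex r i ∈ Λ} x)) i =
      entry (cut (box 0 j) ((∑ m ∈ boxFinset N n, ψ m) x)) i
    by_cases hi : i ∈ (box 0 j : Set (Fin N → ℤ))
    swap
    · rw [entry_cut_of_notMem hi, entry_cut_of_notMem hi]
    rw [entry_cut_of_mem hi, entry_cut_of_mem hi, sum_apply, entry_sum]
    have hmem : cubeIndex r i ∈ boxFinset N n := by
      rw [mem_boxFinset, pi_norm_le_iff_of_nonneg (Nat.cast_nonneg n)]
      intro a
      have h3 : ‖i a‖ ≤ j := by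
        rw [mem_box, sub_zero] at hi
        exact (norm_le_pi_norm i a).trans hi
      rw [Int.norm_eq_abs, ← Int.cast_abs] at h3 ⊢
      have h3' : |i a| ≤ (j : ℤ) := by exact_mod_cast h3
      have h4 : |cubeIndex r i a| ≤ (n : ℤ) := by
        refine le_trans ?_ (h3'.trans (by exact_mod_cast le_max_right n₀ j))
        exact Int.abs_ediv_le_abs _ _
      exact_mod_cast h4
    rw [Finset.sum_eq_single_of_mem _ hmem fun m _ hm => by
      rw [hψ]
      dsimp only
      split_ifs
      · exact entry_cut_of_notMem (fun h => hm (mem_cube.1 h).symm) _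
      · rfl]
    rw [hψ]
    dsimp only
    by_cases hiΛ : cubeIndex r i ∈ Λ
    · rw [entry_cut_of_mem (S := {i | cubeIndex r i ∈ Λ}) hiΛ, if_pos hiΛ,
        entry_cut_of_mem (mem_cube.2 rfl)]
    · rw [entry_cut_of_notMem (S := {i | cubeIndex r i ∈ Λ}) hiΛ, if_neg hiΛ]
      rfl
  have h3 : cut (box 0 j) * (A * C - cut {i | cubeIndex r i ∈ Λ}) =
      cut (box 0 j) * ∑ m ∈ boxFinset N n, (A * T m - ψ m) := by
    rw [mul_sub, h2, ← mul_assoc, h1, mul_assoc, ← mul_sub, Finset.mul_sum,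
      Finset.sum_sub_distrib]
  rw [h3]
  refine (norm_mul_le _ _).trans ((mul_le_of_le_one_left (norm_nonneg _) (norm_cut_le _)).trans ?_)
  -- The differences are again blocks: since `w ≤ r`, applying `A` widens the output box from `2 r`
  -- to at most `3 r`.
  refine norm_sum_block_le hr _ _ (fun m => ?_) (fun m => ?_) fun m => ?_
  · have hr0 : (0 : ℝ) < r := by exact_mod_cast hr
    have h4 : cut (box (corner r m) (3 * r)) * ψ m = ψ m := by
      rw [hψ]
      dsimp only
      split_ifs
      · rw [cut_mul_cut, Set.inter_eq_right.2]
        exact (cube_subset_box hr m).trans fun i hi => (mem_box.1 hi).trans (by linarith)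
      · rw [mul_zero]
    have h5 : cut (box (corner r m) (3 * r))ᶜ * A * cut (box (corner r m) (2 * r)) = 0 := by
      refine hA.cut_mul_mul_cut_eq_zero fun i hi k hk hik => hi ?_
      rw [mem_box] at *
      have := norm_sub_le (k - corner r m) (k - i)
      rw [sub_sub_sub_cancel_left] at this
      linarith
    have h6 : cut (box (corner r m) (3 * r)) * (A * T m) = A * T m := by
      rw [← sub_eq_zero, ← neg_eq_zero, neg_sub]
      calc A * T m - cut (box (corner r m) (3 * r)) * (A * T m) =
          (1 - cut (box (corner r m) (3 * r))) * A * T m := by noncomm_ring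
        _ = (1 - cut (box (corner r m) (3 * r))) * A * (cut (box (corner r m) (2 * r)) * T m) := by
          rw [hl]
        _ = 0 := by rw [one_sub_cut, ← mul_assoc, h5, zero_mul]
    rw [mul_sub, h4, h6]
  · have h4 : ψ m * cut (cube r m) = ψ m := by
      rw [hψ]
      dsimp only
      split_ifs
      · rw [cut_mul_cut, Set.inter_self]
      · rw [zero_mul]
    rw [sub_mul, h4, mul_assoc, hc]
  · by_cases hm : m ∈ Λ
    · simp only [hψ, if_pos hm]
      exact hη m hm
    · simp only [hψ, if_neg hm, hΛ m hm, mul_zero, sub_self, norm_zero]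
      exact hη0

/-- The parametrix is the sum over far cubes of a local inverse, restricted to the cube on the right
and smoothed by a trapezoidal function on the left. The cubes near the origin leave a finite, hence
`P`-compact, defect. -/
theorem exists_right_parametrix [CompleteSpace E] {A : SeqSpace N p E →L[ℂ] SeqSpace N p E}
    (hA : IsBandDominated A) (hrich : IsRich A) {c : ℝ} (hc0 : 0 ≤ c)
    (hc : ∀ D ∈ opSpectrum A, ∃ C, D * C = 1 ∧ C * D = 1 ∧ ‖C‖ ≤ c) :
    ∃ T ∈ pAlgebra (canonProj N p E), ∃ K, IsPCompact (canonProj N p E) K ∧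
      ‖1 - A * T - K‖ ≤ 1 / 2 := by
  classical
  set M : ℝ := 7 ^ N with hM
  have hM0 : 0 < M := by positivity
  -- Error budget: commutator, band approximation and local inversion cost `1 / (8 M)` each per
  -- block, hence `3 / 8` after summation; replacing `A'` by `A` in front of the sum costs another
  -- `1 / 8`. Writing `c + 1` avoids division by zero.
  obtain ⟨A', hA', hAA'⟩ := hA.exists_band (show 0 < 1 / (8 * M * (c + 1)) by positivity)
  obtain ⟨w, hw, hprop⟩ := hA'.exists_hasPropagation
  obtain ⟨κ, hκ, hcomm⟩ := hA'.exists_norm_commutator_le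
  obtain ⟨n, hn⟩ := exists_nat_ge (w + κ * (8 * M * (c + 1)))
  have hκ0 : 0 ≤ κ * (8 * M * (c + 1)) := by positivity
  set r : ℕ := n + 1 with hrdef
  have hrpos : 0 < r := Nat.succ_pos n
  have hr1 : w + κ * (8 * M * (c + 1)) ≤ r := by rw [hrdef]; push_cast; linarith
  have hr : (0 : ℝ) < r := by positivity
  have hκr : κ / r ≤ 1 / (8 * M * (c + 1)) := by
    rw [div_le_div_iff₀ hr (by positivity)]
    linarith
  obtain ⟨ρ, hρ⟩ := exists_local_inverse hrich hc (2 * r) (show 0 < 1 / (8 * M) by positivity)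
  have hB : ∀ k : Fin N → ℤ, ∃ B : SeqSpace N p E →L[ℂ] SeqSpace N p E, ρ < ‖k‖ →
      ‖B‖ ≤ c ∧ ‖cut (box k (2 * r)) * (A * B - 1)‖ ≤ 1 / (8 * M) := by
    intro k
    by_cases hk : ρ < ‖k‖
    · obtain ⟨B, h1, h2, -⟩ := hρ k hk
      exact ⟨B, fun _ => ⟨h1, h2⟩⟩
    · exact ⟨0, fun h => absurd h hk⟩
  choose B hB using hB
  set Λ : Set (Fin N → ℤ) := {m | ρ < ‖corner r m‖}
  set T : (Fin N → ℤ) → SeqSpace N p E →L[ℂ] SeqSpace N p E := fun m =>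
    if m ∈ Λ then trapOp p E r (corner r m) * B (corner r m) * cut (cube r m) else 0 with hT
  have hTm : ∀ m ∈ Λ, T m = trapOp p E r (corner r m) * B (corner r m) * cut (cube r m) :=
    fun m hm => if_pos hm
  have hT0 : ∀ m ∉ Λ, T m = 0 := fun m hm => if_neg hm
  have hl : ∀ m, cut (box (corner r m) (2 * r)) * T m = T m := by
    intro m
    by_cases hm : m ∈ Λ
    · rw [hTm m hm, ← mul_assoc, ← mul_assoc, cut_mul_trapOp_of_subset hr subset_rfl]
    · rw [hT0 m hm, mul_zero]
  have hcr : ∀ m, T m * cut (cube r m) = T m := by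
    intro m
    by_cases hm : m ∈ Λ
    · rw [hTm m hm, mul_assoc, cut_mul_cut, Set.inter_self]
    · rw [hT0 m hm, zero_mul]
  have hTn : ∀ m, ‖T m‖ ≤ c := by
    intro m
    by_cases hm : m ∈ Λ
    · rw [hTm m hm]
      refine (norm_mul_le _ _).trans ((mul_le_of_le_one_right (norm_nonneg _)
        (norm_cut_le _)).trans ((norm_mul_le _ _).trans ((mul_le_of_le_one_left (norm_nonneg _)
        (norm_trapOp_le _ _)).trans (hB _ hm).1)))
    · rw [hT0 m hm, norm_zero]; exact hc0
  obtain ⟨C, hCn, hCprop, hC⟩ := exists_block_sum hrpos T hl hcr hTn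
  have hη : ∀ m ∈ Λ, ‖A' * T m - cut (cube r m)‖ ≤ 3 / (8 * M) := by
    intro m hm
    rw [hTm m hm]
    set k := corner r m
    have h1 : A' * (trapOp p E r k * B k * cut (cube r m)) - cut (cube r m) =
        ((A' * trapOp p E r k - trapOp p E r k * A') * B k - trapOp p E r k * ((A - A') * B k) +
          trapOp p E r k * (cut (box k (2 * r)) * (A * B k - 1))) * cut (cube r m) := by
      have h2 := trapOp_mul_cut (p := p) (E := E) hr (cube_subset_box hrpos m)
      rw [← mul_assoc (trapOp p E r k) (cut (box k (2 * r))),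
        trapOp_mul_cut_of_subset hr subset_rfl]
      nth_rewrite 2 [← h2]
      noncomm_ring
    rw [h1]
    refine (norm_mul_le _ _).trans ((mul_le_of_le_one_right (norm_nonneg _)
      (norm_cut_le _)).trans ?_)
    have h3 : ‖(A' * trapOp p E r k - trapOp p E r k * A') * B k‖ ≤ 1 / (8 * M) := by
      refine (norm_mul_le _ _).trans ?_
      calc _ ≤ 1 / (8 * M * (c + 1)) * (c + 1) := by
            gcongr
            · exact (hcomm r hr k).trans hκr
            · linarith [(hB k hm).1]
        _ = _ := by field_simp
    have h4 : ‖trapOp p E r k * ((A - A') * B k)‖ ≤ 1 / (8 * M) := by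
      refine (norm_mul_le _ _).trans ((mul_le_of_le_one_left (norm_nonneg _)
        (norm_trapOp_le _ _)).trans ((norm_mul_le _ _).trans ?_))
      calc _ ≤ 1 / (8 * M * (c + 1)) * (c + 1) := by
            gcongr
            linarith [(hB k hm).1]
        _ = _ := by field_simp
    have h5 : ‖trapOp p E r k * (cut (box k (2 * r)) * (A * B k - 1))‖ ≤ 1 / (8 * M) :=
      (norm_mul_le _ _).trans ((mul_le_of_le_one_left (norm_nonneg _)
        (norm_trapOp_le _ _)).trans (hB k hm).2)
    have h6 : (3 : ℝ) / (8 * M) = 1 / (8 * M) + 1 / (8 * M) + 1 / (8 * M) := by ring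
    rw [h6]
    exact (norm_add_le _ _).trans (add_le_add ((norm_sub_le _ _).trans (add_le_add h3 h4)) h5)
  have hmain := hprop.norm_mul_sub_cut_le hrpos (by linarith) hl hcr hC Λ
    (show (0 : ℝ) ≤ 3 / (8 * M) by positivity) hη hT0
  set Ω : Set (Fin N → ℤ) := {i | cubeIndex r i ∈ Λ}
  have hΩ : Ωᶜ.Finite := by
    refine (finite_box 0 (ρ + r)).subset fun i hi => ?_
    have h1 : ‖corner r (cubeIndex r i)‖ ≤ ρ := not_lt.1 hi
    have h2 := mem_box.1 (cube_subset_box hrpos (cubeIndex r i) (mem_cube.2 rfl))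
    have h3 := norm_add_le (i - corner r (cubeIndex r i)) (corner r (cubeIndex r i))
    rw [sub_add_cancel] at h3
    rw [mem_box, sub_zero]
    linarith
  refine ⟨C, hCprop.mem_pAlgebra, cut Ωᶜ, isPCompact_cut hΩ, ?_⟩
  have h1 : 1 - A * C - cut Ωᶜ = -((A' * C - cut Ω) + (A - A') * C) := by
    rw [← one_sub_cut]; noncomm_ring
  rw [h1, norm_neg]
  refine (norm_add_le _ _).trans ?_
  have h2 : ‖(A - A') * C‖ ≤ 1 / 8 := by
    refine (norm_mul_le _ _).trans ?_
    calc _ ≤ 1 / (8 * M * (c + 1)) * (M * (c + 1)) := by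
          gcongr
          refine hCn.trans ?_
          gcongr
          linarith
      _ = _ := by field_simp
  have h3 : 7 ^ N * (3 / (8 * M)) = 3 / 8 := by
    rw [← hM]; field_simp
  linarith

/-! ### Invertibility modulo `P`-compact operators -/

/-- A local inverse of norm at most `c` bounds `A` below by nearly `1 / c` on sequences supported in
one far box, and `exists_lower_bound` globalizes this. The gap `1 / c - ν` is spent half on the
local inverse, half on globalizing. -/
theorem exists_lower_bound_off_box {A : SeqSpace N p E →L[ℂ] SeqSpace N p E}
    (hA : IsBandDominated A) (hrich : IsRich A) {c : ℝ} (hc0 : 0 < c)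
    (hc : ∀ D ∈ opSpectrum A, ∃ C, D * C = 1 ∧ C * D = 1 ∧ ‖C‖ ≤ c) {ν : ℝ} (hν : ν < 1 / c) :
    ∃ m : ℕ, ∀ x, (∀ i ∈ box 0 (m : ℝ), entry x i = 0) → ν * ‖x‖ ≤ ‖A x‖ := by
  have hδ : 0 < 1 / c - ν := sub_pos.2 hν
  obtain ⟨R, hR⟩ := hA.exists_lower_bound (half_pos hδ)
  obtain ⟨ρ, hρ⟩ := exists_local_inverse hrich hc R (mul_pos hc0 (half_pos hδ))
  obtain ⟨m, hm⟩ := exists_nat_ge (ρ + R)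
  refine ⟨m, fun x hx => ?_⟩
  have key := hR (box 0 m)ᶜ (1 / c - (1 / c - ν) / 2) (fun k x hx => ?_) x
    fun i hi => hx i (Set.notMem_compl_iff.1 hi)
  · exact (by ring : ν = 1 / c - (1 / c - ν) / 2 - (1 / c - ν) / 2) ▸ key
  -- If the support region is nonempty, the choice `m ≥ ρ + R` forces the centre `k` beyond `ρ`.
  · by_cases hne : ∃ i, i ∈ (box 0 m)ᶜ ∩ box k R
    · obtain ⟨i, hi0, hik⟩ := hne
      have hk : ρ < ‖k‖ := by
        rw [Set.mem_compl_iff, mem_box, sub_zero, not_le] at hi0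
        rw [mem_box] at hik
        have := norm_add_le (i - k) k
        rw [sub_add_cancel] at this
        linarith
      obtain ⟨B, hB, -, hBA⟩ := hρ k hk
      have hcut : cut (box k R) x = x := cut_apply_eq_self fun i hi => hx i fun h => hi h.2
      have h1 : ‖B (A x) - x‖ ≤ c * ((1 / c - ν) / 2) * ‖x‖ := by
        have := ContinuousLinearMap.le_of_opNorm_le _ hBA x
        have h2 : ((B * A - 1) * cut (box k R) : SeqSpace N p E →L[ℂ] SeqSpace N p E) x =
            B (A (cut (box k R) x)) - cut (box k R) x := rfl
        rwa [h2, hcut] at this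
      have h2 : ‖B (A x)‖ ≤ c * ‖A x‖ := B.le_of_opNorm_le hB _
      have h3 := norm_sub_le (B (A x)) (B (A x) - x)
      rw [sub_sub_cancel] at h3
      have h4 : c * ((1 / c - (1 / c - ν) / 2) * ‖x‖) =
          ‖x‖ - c * ((1 / c - ν) / 2) * ‖x‖ := by
        field_simp
      refine le_of_mul_le_mul_left ?_ hc0
      linarith
    · have h0 : x = 0 := ext fun i => hx i fun h => hne ⟨i, h⟩
      rw [h0, map_zero, norm_zero, mul_zero]

/-- If `A` is bounded below by `ν` far out and `A T` equals `L` modulo a `P`-compact operator, then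
the norm of `T` modulo `P`-compact operators is at most `‖L‖ / ν`. -/
theorem exists_isPCompact_norm_add_le {A T L : SeqSpace N p E →L[ℂ] SeqSpace N p E}
    (hA : A ∈ pAlgebra (canonProj N p E)) (hT : T ∈ pAlgebra (canonProj N p E)) {ν : ℝ}
    (hν : 0 ≤ ν) {m : ℕ}
    (hlow : ∀ x, (∀ i ∈ box 0 (m : ℝ), entry x i = 0) → ν * ‖x‖ ≤ ‖A x‖)
    (hL : IsPCompact (canonProj N p E) (A * T - L)) {δ : ℝ} (hδ : 0 < δ) :
    ∃ K, IsPCompact (canonProj N p E) K ∧ ν * ‖T + K‖ ≤ ‖L‖ + δ := by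
  set P := canonProj N p E
  have hP : ∀ n, IsPCompact P (P n) := fun n => by
    rw [show P n = _ from canonProj_eq n]
    exact isPCompact_cut (finite_box _ _)
  have hneg : ∀ {K}, IsPCompact P K → IsPCompact P (-K) := fun hK => by
    simpa using hK.smul (-1)
  have hPT : IsPCompact P (P m * T) := (hT _ (hP m)).2
  have hK' : IsPCompact P (A * T - L + -(A * (P m * T))) := hL.add (hneg (hA _ hPT).1)
  obtain ⟨n, hn⟩ := (NormedAddGroup.tendsto_nhds_zero.1
    ((isPCompact_iff _ _).1 hK').2 δ hδ).exists
  -- This correction turns `T` into `(1 - P m) * T * (1 - P n)`: the left factor moves the range to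
  -- where `A` is bounded below, and the right factor makes the `P`-compact part of `A * (1 - P m) *
  -- T` small.
  refine ⟨-(P m * T) + -(T * P n) + P m * T * P n,
    ((hneg hPT).add (hneg (hT _ (hP n)).1)).add (hPT.mem_pAlgebra _ (hP n)).1, ?_⟩
  have h1 : T + (-(P m * T) + -(T * P n) + P m * T * P n) = (1 - P m) * T * (1 - P n) := by
    noncomm_ring
  have h2 : A * ((1 - P m) * T * (1 - P n)) =
      L * (1 - P n) + (A * T - L + -(A * (P m * T))) * (1 - P n) := by
    noncomm_ring
  have h3 : ‖A * ((1 - P m) * T * (1 - P n))‖ ≤ ‖L‖ + δ := by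
    rw [h2]
    refine (norm_add_le _ _).trans (add_le_add ((norm_mul_le _ _).trans
      (mul_le_of_le_one_right (norm_nonneg _) (norm_one_sub_canonProj_le n))) hn.le)
  rw [h1]
  rcases hν.eq_or_lt with h0 | hν0
  · rw [← h0, zero_mul]
    positivity
  rw [← le_div_iff₀' hν0]
  refine ContinuousLinearMap.opNorm_le_bound _ (by positivity) fun x => ?_
  rw [div_mul_eq_mul_div, le_div_iff₀' hν0]
  refine (hlow _ fun i hi => ?_).trans (ContinuousLinearMap.le_of_opNorm_le _ h3 x)
  have : ((1 - P m) * T * (1 - P n) : SeqSpace N p E →L[ℂ] SeqSpace N p E) x =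
      cut (box 0 (m : ℝ))ᶜ ((T * (1 - P n)) x) := by
    rw [show P m = _ from canonProj_eq m, one_sub_cut, mul_assoc]
    rfl
  rw [this]
  exact entry_cut_of_notMem (Set.notMem_compl_iff.2 hi) _

theorem mk_eq_mk_iff (A B : pAlgebra (canonProj N p E)) :
    PQuotient.mk (canonProj N p E) A = PQuotient.mk (canonProj N p E) B ↔
      IsPCompact (canonProj N p E) ((A : SeqSpace N p E →L[ℂ] SeqSpace N p E) - B) :=
  Ideal.Quotient.mk_eq_mk_iff_sub_mem A B

theorem mk_surjective : Function.Surjective (PQuotient.mk (canonProj N p E)) :=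
  Ideal.Quotient.mk_surjective

theorem isPCompact_mul_sub_one_iff (A B : pAlgebra (canonProj N p E)) :
    IsPCompact (canonProj N p E) ((A : SeqSpace N p E →L[ℂ] SeqSpace N p E) * B - 1) ↔
      PQuotient.mk (canonProj N p E) A * PQuotient.mk _ B = 1 := by
  rw [← map_mul, ← map_one (PQuotient.mk (canonProj N p E)), mk_eq_mk_iff]
  rfl

/-- The Neumann series is summed in `L(X, P)`, which is complete as a closed subalgebra: `A T + K`
is invertible there, hence `A T` is invertible in the quotient. -/
theorem exists_mk_mul_eq_one [CompleteSpace E] {A T : pAlgebra (canonProj N p E)}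
    {K : SeqSpace N p E →L[ℂ] SeqSpace N p E} (hK : IsPCompact (canonProj N p E) K)
    (h : ‖1 - (A : SeqSpace N p E →L[ℂ] SeqSpace N p E) * T - K‖ < 1) :
    ∃ B, PQuotient.mk (canonProj N p E) A * B = 1 := by
  have : CompleteSpace (pAlgebra (canonProj N p E)) := isClosed_pAlgebra.completeSpace_coe
  obtain ⟨K, rfl⟩ : ∃ L : pAlgebra (canonProj N p E),
    (L : SeqSpace N p E →L[ℂ] SeqSpace N p E) = K := ⟨⟨K, hK.mem_pAlgebra⟩, rfl⟩
  have hu : IsUnit (A * T + K) := by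
    have := isUnit_one_sub_of_norm_lt_one (x := 1 - A * T - K) h
    rwa [sub_sub, sub_sub_cancel] at this
  have hmk : PQuotient.mk (canonProj N p E) (A * T + K) =
      PQuotient.mk _ A * PQuotient.mk _ T := by
    rw [← map_mul, mk_eq_mk_iff]
    simpa using hK
  have hu' := hu.map (PQuotient.mk (canonProj N p E))
  rw [hmk] at hu'
  obtain ⟨v, hv⟩ := hu'.exists_right_inv
  exact ⟨_, by rw [← mul_assoc]; exact hv⟩

theorem isUnit_mk_of_opSpectrum [CompleteSpace E] (A : pAlgebra (canonProj N p E))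
    (hband : IsBandDominated (A : SeqSpace N p E →L[ℂ] SeqSpace N p E))
    (hrich : IsRich (A : SeqSpace N p E →L[ℂ] SeqSpace N p E)) {c : ℝ} (hc0 : 0 < c)
    (hc : ∀ D ∈ opSpectrum (A : SeqSpace N p E →L[ℂ] SeqSpace N p E),
      ∃ C, D * C = 1 ∧ C * D = 1 ∧ ‖C‖ ≤ c) :
    IsUnit (PQuotient.mk (canonProj N p E) A) ∧
      ‖Ring.inverse (PQuotient.mk (canonProj N p E) A)‖ ≤ c := by
  obtain ⟨T, hT, K, hK, hle⟩ := exists_right_parametrix hband hrich hc0.le hc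
  obtain ⟨b, hb⟩ := exists_mk_mul_eq_one (A := A) (T := ⟨T, hT⟩) hK
    (hle.trans_lt (by norm_num))
  obtain ⟨B, rfl⟩ := mk_surjective b
  have hAB : IsPCompact (canonProj N p E)
      ((A : SeqSpace N p E →L[ℂ] SeqSpace N p E) * B - 1) :=
    (isPCompact_mul_sub_one_iff A B).2 hb
  have hBA : PQuotient.mk (canonProj N p E) B * PQuotient.mk _ A = 1 := by
    rw [← map_mul, ← map_one (PQuotient.mk (canonProj N p E)), mk_eq_mk_iff]
    have hν : 1 / (2 * c) < 1 / c := by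
      rw [div_lt_div_iff₀ (by positivity) hc0]; linarith
    obtain ⟨m, hm⟩ := exists_lower_bound_off_box hband hrich hc0 hc hν
    -- Since `A (B A - 1)` is `P`-compact, the lower bound makes `B A - 1` arbitrarily close to
    -- `P`-compact operators.
    refine isPCompact_of_closure norm_one_sub_canonProj_le fun δ hδ => ?_
    have hABA : IsPCompact (canonProj N p E) ((A : SeqSpace N p E →L[ℂ] SeqSpace N p E) *
        (B * A - 1 : pAlgebra (canonProj N p E)) - 0) := by
      have h1 : (A : SeqSpace N p E →L[ℂ] SeqSpace N p E) *
          (B * A - 1 : pAlgebra (canonProj N p E)) - 0 = (A * B - 1) * A := by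
        push_cast
        noncomm_ring
      rw [h1]
      exact (A.2 _ hAB).2
    obtain ⟨L, hL, hle⟩ := exists_isPCompact_norm_add_le A.2 (B * A - 1).2
      (show (0 : ℝ) ≤ 1 / (2 * c) by positivity) hm hABA
      (show 0 < δ / (2 * c) by positivity)
    refine ⟨-L, by simpa using hL.smul (-1), ?_⟩
    rw [norm_zero, zero_add, div_mul_eq_mul_div, one_mul,
      div_le_div_iff_of_pos_right (by positivity)] at hle
    rw [sub_neg_eq_add]
    exact hle
  have hinv : Ring.inverse (PQuotient.mk (canonProj N p E) A) = PQuotient.mk _ B :=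
    Ring.inverse_unit ⟨_, _, hb, hBA⟩
  refine ⟨⟨⟨_, _, hb, hBA⟩, rfl⟩, ?_⟩
  rw [hinv]
  refine le_of_forall_gt fun s hs => ?_
  rw [PQuotient.norm_mk_lt_iff]
  -- With `ν = 2 / (c + s)` and the tolerance below, the resulting norm is at most `(c + s) / 2 + (s
  -- - c) / 4 < s`.
  have hcs : c < (c + s) / 2 := by linarith
  have hν : 1 / ((c + s) / 2) < 1 / c := one_div_lt_one_div_of_lt hc0 hcs
  obtain ⟨m, hm⟩ := exists_lower_bound_off_box hband hrich hc0 hc hν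
  have hν0 : 0 < 1 / ((c + s) / 2) := by have := hc0.trans hcs; positivity
  obtain ⟨L, hL, hle⟩ := exists_isPCompact_norm_add_le A.2 B.2 hν0.le hm hAB
    (show 0 < (s - c) / (2 * (c + s)) from div_pos (by linarith) (by linarith))
  refine ⟨L, hL, ?_⟩
  rw [div_mul_eq_mul_div, one_mul, div_le_iff₀ (by linarith)] at hle
  have h1 : ‖(1 : SeqSpace N p E →L[ℂ] SeqSpace N p E)‖ ≤ 1 := ContinuousLinearMap.norm_id_le
  have h2 : (s - c) / (2 * (c + s)) * ((c + s) / 2) = (s - c) / 4 := by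
    have : c + s ≠ 0 := by linarith
    field_simp
    norm_num
  have h3 : (‖(1 : SeqSpace N p E →L[ℂ] SeqSpace N p E)‖ + (s - c) / (2 * (c + s))) *
      ((c + s) / 2) ≤ (1 + (s - c) / (2 * (c + s))) * ((c + s) / 2) := by
    gcongr
    linarith
  rw [add_mul, h2] at h3
  linarith

theorem isUnit_of_isUnit_mk [CompleteSpace E] (A : pAlgebra (canonProj N p E))
    (hband : IsBandDominated (A : SeqSpace N p E →L[ℂ] SeqSpace N p E))
    (hA : IsUnit (PQuotient.mk (canonProj N p E) A)) {c : ℝ}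
    (hc : ‖Ring.inverse (PQuotient.mk (canonProj N p E) A)‖ ≤ c)
    {D : SeqSpace N p E →L[ℂ] SeqSpace N p E}
    (hD : D ∈ opSpectrum (A : SeqSpace N p E →L[ℂ] SeqSpace N p E)) :
    IsUnit D ∧ ‖Ring.inverse D‖ ≤ c := by
  obtain ⟨h, hh, hlim⟩ := hD
  obtain ⟨B, hB⟩ := mk_surjective (Ring.inverse (PQuotient.mk (canonProj N p E) A))
  have key : ∀ t, c < t → ∃ C, D * C = 1 ∧ C * D = 1 ∧ ‖C‖ ≤ t := by
    intro t ht
    -- The quotient norm is an infimum that need not be attained, so representatives are taken of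
    -- norm below `t > c`. Since the inverse of `D` is unique, the bounds for all such `t` apply to
    -- one operator.
    obtain ⟨K, hK, hlt⟩ := (PQuotient.norm_mk_lt_iff _ B t).1 (hB ▸ hc.trans_lt ht)
    obtain ⟨B', hB'⟩ : ∃ B' : pAlgebra (canonProj N p E),
      (B' : SeqSpace N p E →L[ℂ] SeqSpace N p E) = B + K := ⟨B + ⟨K, hK.mem_pAlgebra⟩, rfl⟩
    have hBK : PQuotient.mk (canonProj N p E) B' =
        Ring.inverse (PQuotient.mk (canonProj N p E) A) := by
      rw [← hB, mk_eq_mk_iff, hB', add_sub_cancel_left]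
      exact hK
    rw [← hB'] at hlt
    have h1 := (isPCompact_mul_sub_one_iff A B').2 (by rw [hBK, Ring.mul_inverse_cancel _ hA])
    have h2 := (isPCompact_mul_sub_one_iff B' A).2 (by rw [hBK, Ring.inverse_mul_cancel _ hA])
    exact hlim.exists_inverse hband hlt.le h1 h2 hh
  have hinv : ∀ C, D * C = 1 → C * D = 1 → Ring.inverse D = C := fun C h1 h2 =>
    Ring.inverse_unit ⟨D, C, h1, h2⟩
  obtain ⟨C, h1, h2, -⟩ := key (c + 1) (by linarith)
  refine ⟨⟨⟨D, C, h1, h2⟩, rfl⟩, le_of_forall_gt_imp_ge_of_dense fun t ht => ?_⟩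
  obtain ⟨C', h1', h2', hle⟩ := key t ht
  rwa [hinv C' h1' h2']

end SeqSpace

/-! ### Pseudospectra -/

theorem not_lt_invNorm_iff {B : Type*} [Ring B] [Norm B] {b : B} {ε : ℝ} (hε : 0 < ε) :
    ¬ ENNReal.ofReal (1 / ε) < invNorm b ↔ IsUnit b ∧ ‖Ring.inverse b‖ ≤ 1 / ε := by
  unfold invNorm
  split_ifs with h
  · rw [ENNReal.ofReal_lt_ofReal_iff_of_nonneg (by positivity), not_lt]
    exact ⟨fun h' => ⟨h, h'⟩, fun h' => h'.2⟩
  · exact ⟨fun h' => absurd ENNReal.ofReal_lt_top h', fun h' => absurd h'.1 h⟩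

theorem theorem4p3 (N : ℕ) (p : ENNReal) [Fact (p = 0 ∨ 1 ≤ p)]
    (E : Type*) [NormedAddCommGroup E] [NormedSpace ℂ E] [CompleteSpace E]
    (A : pAlgebra (canonProj N p E))
    (hband : IsBandDominated (A : SeqSpace N p E →L[ℂ] SeqSpace N p E))
    (hrich : IsRich (A : SeqSpace N p E →L[ℂ] SeqSpace N p E))
    (ε : ℝ) (hε : 0 < ε) :
    essPseudospectrum (canonProj N p E) ε A =
      ⋃ B ∈ opSpectrum (A : SeqSpace N p E →L[ℂ] SeqSpace N p E), epsPseudospectrum ε B := by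
  ext z
  have hcoe : ((A - algebraMap ℂ _ z : pAlgebra (canonProj N p E)) :
      SeqSpace N p E →L[ℂ] SeqSpace N p E) = A - z • 1 := by
    rw [Subalgebra.coe_sub, Algebra.algebraMap_eq_smul_one]
    rfl
  have hband' := hband.sub_smul_one z
  have hrich' := hrich.sub_smul_one z
  rw [← hcoe] at hband' hrich'
  have hleft : z ∈ essPseudospectrum (canonProj N p E) ε A ↔ ENNReal.ofReal (1 / ε) <
      invNorm (PQuotient.mk (canonProj N p E) (A - algebraMap ℂ _ z)) := by
    rw [map_sub, AlgHom.commutes]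
    rfl
  -- Complements turn the union into a statement about all limit operators, with the non-strict
  -- bound `1 / ε`.
  rw [hleft, ← not_iff_not, not_lt_invNorm_iff hε]
  simp only [Set.mem_iUnion, not_exists]
  constructor
  · rintro ⟨hu, hle⟩ B ⟨h, hh, hB⟩ hz
    have hB' := hB.sub_smul_one z
    rw [← hcoe] at hB'
    refine (not_lt_invNorm_iff hε).2
      (SeqSpace.isUnit_of_isUnit_mk _ hband' hu hle ⟨h, hh, hB'⟩) ?_
    rw [← Algebra.algebraMap_eq_smul_one]
    exact hz
  · intro hall
    refine SeqSpace.isUnit_mk_of_opSpectrum _ hband' hrich' (by positivity) ?_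
    rintro D ⟨h, hh, hD⟩
    -- Every limit operator of `A - z` arises from one of `A`, namely `D + z`.
    have hB := hD.sub_smul_one (-z)
    rw [hcoe, neg_smul, sub_neg_eq_add, sub_neg_eq_add, sub_add_cancel] at hB
    have h1 := hall _ ⟨h, hh, hB⟩
    change ¬ ENNReal.ofReal (1 / ε) < invNorm (D + z • 1 - algebraMap ℂ _ z) at h1
    rw [Algebra.algebraMap_eq_smul_one, add_sub_cancel_right, not_lt_invNorm_iff hε] at h1
    exact ⟨Ring.inverse D, Ring.mul_inverse_cancel _ h1.1, Ring.inverse_mul_cancel _ h1.1, h1.2⟩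

end
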